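/- Let $n\ge 1$, let $H$ be a finite simple graph on the vertex set $\{x_1,\dots,x_n\}$, and let $G=H^*$ be its whisker graph, that is, the graph on $\{x_1,\dots,x_n,y_1,\dots,y_n\}$ whose edges are the edges of $H$ together with the whiskers $x_1y_1,\dots,x_ny_n$. Let $K$ be a field, $S=K[x_1,\dots,x_n,y_1,\dots,y_n]$, and let $J(G)\subset S$ be the cover ideal of $G$, generated by the monomials $\prod_{v\in C}v$, where $C$ runs over the minimal vertex covers of $G$. (a) For all $k\ge 1$, the ideal $J(G)^k$ has linear quotients with respect to the lexicographic order $>_{\mathrm{lex}}$ induced by $x_1>y_1>x_2>y_2>\cdots>x_n>y_n$; that is, if $u_1>_{\mathrm{lex}}u_2>_{\mathrm{lex}}\cdots>_{\mathrm{lex}}u_m$ are the minimal monomial generators of $J(G)^k$, then every colon ideal $(u_1,\dots,u_{\ell-1}):u_\ell$, $\ell=2,\dots,m$, is generated by a subset of the variables. (b) $J(G)$ has linear powers, that is, for all $k\ge 1$ the ideal $J(G)^k$ has a linear resolution: its minimal graded free resolution has the form $\cdots\to S(-d-1)^{b_1}\to S(-d)^{b_0}\to J(G)^k\to 0$ for some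 integer $d$ (depending on $k$). In particular, $\operatorname{depth} S/J(G)^k\ge\operatorname{depth} S/J(G)^{k+1}$ for all $k\ge 1$, where depth is taken with respect to the graded maximal ideal of $S$. -/

import Mathlib

noncomputable section

/-! ### Graphs: whisker graphs and cover ideals -/

/-- The vertex set `{x_1, y_1, …, x_n, y_n}` of a whisker graph, linearly ordered as
`x_1, y_1, x_2, y_2, …, x_n, y_n`. The indices `1, …, n` are represented by `Fin n`, the vertex
`x_i` by the pair `(i, 0)`, and the vertex `y_i` by the pair `(i, 1)`. -/
abbrev WhiskerVertex (n : ℕ) : Type := Fin n ×ₗ Fin 2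

/-- The vertex `x_i`. -/
def xVertex {n : ℕ} (i : Fin n) : WhiskerVertex n := toLex (i, 0)

/-- The vertex `y_i`. -/
def yVertex {n : ℕ} (i : Fin n) : WhiskerVertex n := toLex (i, 1)

/-- The whisker graph `H^*` of a graph `H` on `{x_1, …, x_n}`: its edges are the edges
`x_i x_j` of `H`, and the whiskers `x_i y_i`. -/
def whiskerGraph {n : ℕ} (H : SimpleGraph (Fin n)) : SimpleGraph (WhiskerVertex n) where
  Adj v w :=
    (∃ i j, H.Adj i j ∧ v = xVertex i ∧ w = xVertex j) ∨
      ∃ i, (v = xVertex i ∧ w = yVertex i) ∨ (v = yVertex i ∧ w = xVertex i)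
  symm := ⟨by
    rintro v w (⟨i, j, h, hv, hw⟩ | ⟨i, h | h⟩)
    · exact Or.inl ⟨j, i, h.symm, hw, hv⟩
    · exact Or.inr ⟨i, Or.inr ⟨h.2, h.1⟩⟩
    · exact Or.inr ⟨i, Or.inl ⟨h.2, h.1⟩⟩⟩
  loopless := ⟨by
    rintro v (⟨i, j, h, hv, hw⟩ | ⟨i, ⟨hv, hw⟩ | ⟨hv, hw⟩⟩)
    · have hij : i = j := congrArg (fun p => (ofLex p).1) (hv.symm.trans hw)
      exact h.ne hij
    · exact absurd (congrArg (fun p => (ofLex p).2) (hv.symm.trans hw)) (by decide : (0 : Fin 2) ≠ 1)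
    · exact absurd (congrArg (fun p => (ofLex p).2) (hv.symm.trans hw))
        (by decide : (1 : Fin 2) ≠ 0)⟩

/-- A minimal vertex cover of `G`: a vertex cover no proper subset of which is a vertex cover. -/
def IsMinimalVertexCover {V : Type*} (G : SimpleGraph V) (C : Finset V) : Prop :=
  Minimal (fun D : Finset V => G.IsVertexCover (D : Set V)) C

/-- The cover ideal `J(G)`, generated by the squarefree monomials `∏_{v ∈ C} v`, where `C` runs
over the minimal vertex covers of `G`. -/
def coverIdeal {V : Type*} (K : Type*) [Field K] (G : SimpleGraph V) :
    Ideal (MvPolynomial V K) :=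
  Ideal.span {p | ∃ C : Finset V, IsMinimalVertexCover G C ∧ p = ∏ v ∈ C, MvPolynomial.X v}

/-! ### Monomial ideals and linear quotients -/

/-- An ideal generated by monomials. -/
def IsMonomialIdeal {σ K : Type*} [Field K] (I : Ideal (MvPolynomial σ K)) : Prop :=
  ∃ A : Set (σ →₀ ℕ), I = Ideal.span ((fun a => MvPolynomial.monomial a (1 : K)) '' A)

/-- The exponent vectors of the minimal monomial generators of a monomial ideal `I`, that is, of
the monomials in `I` that are minimal with respect to divisibility. -/
def minimalGenerators {σ K : Type*} [Field K] (I : Ideal (MvPolynomial σ K)) : Set (σ →₀ ℕ) :=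
  {a | Minimal (fun b : σ →₀ ℕ => MvPolynomial.monomial b (1 : K) ∈ I) a}

/-- `I` has linear quotients with respect to the monomial order `m`: `I` is a monomial ideal and,
when its minimal monomial generators are listed in decreasing order, `u_1 > u_2 > …`, every colon
ideal `(u_1, …, u_{ℓ-1}) : u_ℓ` is generated by a set of variables. -/
def HasLinearQuotients {σ K : Type*} [Field K] (m : MonomialOrder σ)
    (I : Ideal (MvPolynomial σ K)) : Prop :=
  IsMonomialIdeal I ∧ ∀ u ∈ minimalGenerators I, ∃ T : Set σ,
    (Ideal.span ((fun a => MvPolynomial.monomial a (1 : K)) ''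
        {v | v ∈ minimalGenerators I ∧ m.toSyn u < m.toSyn v})).colon
      {MvPolynomial.monomial u (1 : K)} =
    Ideal.span ((MvPolynomial.X : σ → MvPolynomial σ K) '' T)

/-! ### Linear resolutions -/

/-- `I` has a linear resolution: for some degree `d` there is an exact sequence
`⋯ → S(-d-2)^(b 2) → S(-d-1)^(b 1) → S(-d)^(b 0) → I → 0` of graded `S`-modules.
The augmentation `S(-d)^(b 0) → I` is given by `b 0` forms `g` of degree `d`, and the differential
`S(-d-i-1)^(b (i+1)) → S(-d-i)^(b i)` by a matrix `A i` whose entries are linear forms (possibly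
zero). Since the entries of all `A i` lie in the graded maximal ideal, such a resolution
is automatically the minimal graded free resolution of `I`. -/
def HasLinearResolution {σ K : Type*} [Field K] (I : Ideal (MvPolynomial σ K)) : Prop :=
  ∃ (d : ℕ) (b : ℕ → ℕ) (g : Fin (b 0) → MvPolynomial σ K)
    (A : ∀ i : ℕ, Matrix (Fin (b i)) (Fin (b (i + 1))) (MvPolynomial σ K)),
    (∀ j, (g j).IsHomogeneous d) ∧
    (∀ i r c, (A i r c).IsHomogeneous 1) ∧
    Ideal.span (Set.range g) = I ∧
    Function.Exact (A 0).mulVecLin (Fintype.linearCombination (MvPolynomial σ K) g) ∧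
    ∀ i, Function.Exact (A (i + 1)).mulVecLin (A i).mulVecLin

/-- `I` has linear powers: every power `I ^ k`, `k ≥ 1`, has a linear resolution. -/
def HasLinearPowers {σ K : Type*} [Field K] (I : Ideal (MvPolynomial σ K)) : Prop :=
  ∀ k : ℕ, 1 ≤ k → HasLinearResolution (I ^ k)

/-! ### Depth -/

/-- The depth of `M` with respect to `𝔞`: the supremum of the lengths of the `M`-regular sequences
with all entries in `𝔞`. -/
def moduleDepth {R : Type*} [CommRing R] (𝔞 : Ideal R) (M : Type*) [AddCommGroup M] [Module R M] :
    ℕ∞ :=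
  sSup {l : ℕ∞ | ∃ rs : List R,
    (∀ r ∈ rs, r ∈ 𝔞) ∧ RingTheory.Sequence.IsRegular M rs ∧ l = (rs.length : ℕ∞)}

/-- The depth of the graded module `S / I`, where `S` is a polynomial ring over a field, taken
with respect to the graded maximal ideal of `S`, which is generated by all the variables. -/
def quotientDepth {σ K : Type*} [Field K] (I : Ideal (MvPolynomial σ K)) : ℕ∞ :=
  moduleDepth (MvPolynomial.idealOfVars σ K) (MvPolynomial σ K ⧸ I)

end

/-!
Write `S` for the polynomial ring and `J` for the cover ideal. A minimal vertex cover of the whisker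
graph contains exactly one vertex of each whisker, and its vertices among the `x_i` form an arbitrary
vertex cover of `H`. Hence `J ^ k` is generated by the monomials `∏ x_i ^ (a i) * y_i ^ (k - a i)`,
where `a` runs over the sums of `k` indicator functions of vertex covers of `H` (`IsCoverSum`). As
covers may be enlarged, these sums are closed under increasing an entry that is less than `k`
(`IsCoverSum.add_single`). So if `a i < k`, then `x_i u / y_i` is again a generator and larger than
the generator `u` of `a`, which gives the colon ideal of `u`: it is generated by the `x_i` with
`a i < k` (`colon_coverGenerators`).

Linear quotients pass to syzygies: the first syzygy module of a module with linear quotients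
generated in one degree has linear quotients with respect to linear syzygies
(`HasLinearFiltration.exists_syzygies`). Iterating this gives the linear resolution.

The depth is controlled by the homology of the Koszul complex of all `N = 2 n` variables. Dividing by
a regular element moves nonvanishing Koszul homology up by one degree, so a regular sequence of
length `r` makes the homology vanish above degree `N - r`; conversely, vanishing in the top degree
yields a regular element by prime avoidance. Let `q` be the maximum of `|{i | a i < k}|`. Linear
quotients make the Koszul homology of `S / J ^ k` vanish above degree `q + 1`
(`HasLinearFiltration.acyclicAt`), so that the depth of `S / J ^ k` is at least `N - (q + 1)`. On the
other hand, the cycle `∏ (x_i e_{y_i} - y_i e_{x_i})`, taken over the `i` with `a i < k`, times a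
monomial shows that the Koszul homology of `S / J ^ (k + 1)` in degree `q + 1` is nonzero
(`not_acyclicAt_coverIdeal_pow`), so that the depth of `S / J ^ (k + 1)` is at most `N - (q + 1)`.
-/

noncomputable section

/-! ### The Koszul complex and regular sequences -/

namespace Koszul

open Finset

variable {R : Type*} [CommRing R] {σ : Type*} [LinearOrder σ]

/-- The sign `(-1)^#{j ∈ s | j < i}` of moving `e_i` into its place in the wedge product of the
`e_j`, `j ∈ s`. -/
def sign (R : Type*) [CommRing R] (i : σ) (s : Finset σ) : R := (-1) ^ #{j ∈ s | j < i}

lemma sign_mul_self (i : σ) (s : Finset σ) : sign R i s * sign R i s = 1 := by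
  rw [sign, ← mul_pow]; simp

lemma sign_insert {i j : σ} {s : Finset σ} (hj : j ∉ s) :
    sign R i (insert j s) = if j < i then -sign R i s else sign R i s := by
  rw [sign, sign, filter_insert]
  split_ifs with h
  · rw [card_insert_of_notMem (by simp [hj]), pow_succ]; ring
  · rfl

lemma sign_insert_self {i : σ} {s : Finset σ} (hi : i ∉ s) :
    sign R i (insert i s) = sign R i s := by
  rw [sign_insert hi, if_neg (lt_irrefl i)]

lemma sign_erase_self (i : σ) (s : Finset σ) : sign R i (s.erase i) = sign R i s := by
  by_cases hi : i ∈ s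
  · rw [← sign_insert_self (notMem_erase i s), insert_erase hi]
  · rw [erase_eq_of_notMem hi]

lemma sign_mul_sign_insert {i j : σ} {s : Finset σ} (hij : i ≠ j) (hi : i ∉ s) (hj : j ∉ s) :
    sign R i s * sign R j (insert i s) = -(sign R j s * sign R i (insert j s)) := by
  rw [sign_insert hi, sign_insert hj]
  rcases lt_or_gt_of_ne hij with h | h
  · rw [if_pos h, if_neg h.asymm]; ring
  · rw [if_neg h.asymm, if_pos h]; ring

variable {M : Type*} [AddCommGroup M] [Module R M]

/-- Left multiplication by `e_i` on the Koszul complex with coefficients in `M`. The total complex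
is the module of functions `z : Finset σ → M`, where `z s` is the coefficient of the wedge
product of the `e_j`, `j ∈ s`, in increasing order; homological degree `p` consists of the functions
supported on sets of cardinality `p`. -/
def mulE (R : Type*) [CommRing R] {M : Type*} [AddCommGroup M] [Module R M] (i : σ) :
    (Finset σ → M) →ₗ[R] (Finset σ → M) where
  toFun z s := if i ∈ s then sign R i s • z (s.erase i) else 0
  map_add' z w := by ext s; simp only [Pi.add_apply]; split_ifs <;> simp
  map_smul' r z := by
    ext s; simp only [Pi.smul_apply, RingHom.id_apply]; split_ifs
    · exact smul_comm _ _ _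
    · simp

lemma mulE_apply (i : σ) (z : Finset σ → M) (s : Finset σ) :
    mulE R i z s = if i ∈ s then sign R i s • z (s.erase i) else 0 := rfl

variable [Fintype σ]

/-- The Koszul differential of the elements `x`: contraction of wedge products with the functional
`e_i ↦ x i`. -/
def d (x : σ → R) : (Finset σ → M) →ₗ[R] (Finset σ → M) where
  toFun z s := ∑ i ∈ sᶜ, (sign R i s * x i) • z (insert i s)
  map_add' z w := by ext s; simp [smul_add, sum_add_distrib]
  map_smul' r z := by
    ext s
    simp only [Pi.smul_apply, RingHom.id_apply, smul_sum]
    exact sum_congr rfl fun i _ => smul_comm _ _ _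

lemma d_apply (x : σ → R) (z : Finset σ → M) (s : Finset σ) :
    d x z s = ∑ i ∈ sᶜ, (sign R i s * x i) • z (insert i s) := rfl

lemma d_d (x : σ → R) (z : Finset σ → M) : d x (d x z) = 0 := by
  ext s
  simp only [d_apply, smul_sum, Pi.zero_apply, smul_smul]
  rw [sum_sigma']
  refine sum_involution (fun a _ => ⟨a.2, a.1⟩) ?_ ?_ ?_ ?_
  · rintro ⟨i, j⟩ h
    simp only [mem_sigma, mem_compl, mem_insert, not_or] at h
    obtain ⟨hi, hji, hj⟩ := h
    dsimp only
    rw [insert_comm, ← add_smul]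
    have := sign_mul_sign_insert (R := R) (Ne.symm hji) hi hj
    rw [show sign R i s * x i * (sign R j (insert i s) * x j) +
        sign R j s * x j * (sign R i (insert j s) * x i) =
        (sign R i s * sign R j (insert i s) + sign R j s * sign R i (insert j s)) * (x i * x j)
        by ring, this]
    simp
  · rintro ⟨i, j⟩ h _ h2
    simp only [mem_sigma, mem_compl, mem_insert, not_or] at h
    simp only [Sigma.mk.injEq, heq_eq_eq] at h2
    exact h.2.1 h2.1
  · rintro ⟨i, j⟩ h
    simp only [mem_sigma, mem_compl, mem_insert, not_or] at h ⊢
    exact ⟨h.2.2, Ne.symm h.2.1, h.1⟩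
  · rintro ⟨i, j⟩ _; rfl

/-- The homotopy formula: multiplication by `x i` is null-homotopic on the Koszul complex. -/
lemma d_mulE (x : σ → R) (i : σ) (z : Finset σ → M) :
    d x (mulE R i z) = x i • z - mulE R i (d x z) := by
  ext s
  rw [d_apply, Pi.sub_apply, Pi.smul_apply, mulE_apply]
  by_cases hi : i ∈ s
  · rw [if_pos hi, d_apply, smul_sum]
    have hs : (s.erase i)ᶜ = insert i sᶜ := by
      ext j; by_cases h : j = i <;> simp [h, hi]
    rw [hs, sum_insert (by simpa using hi), insert_erase hi, sign_erase_self, smul_smul,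
      ← mul_assoc, sign_mul_self, one_mul, sub_add_cancel_left, ← sum_neg_distrib]
    refine sum_congr rfl fun j hj => ?_
    rw [mem_compl] at hj
    have hji : j ≠ i := fun h => hj (h ▸ hi)
    rw [mulE_apply, if_pos (mem_insert_of_mem hi), erase_insert_of_ne hji, smul_smul, smul_smul,
      ← neg_smul]
    congr 1
    have h := sign_mul_sign_insert (R := R) hji (s := s.erase i)
      (fun h => hj (mem_of_mem_erase h)) (notMem_erase i s)
    rw [insert_erase hi, sign_erase_self, ← erase_insert_of_ne hji, sign_erase_self] at h
    linear_combination x j * (sign R i s * sign R i (insert j s) * h -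
      sign R i s * sign R j (s.erase i) * sign_mul_self (R := R) i (insert j s) -
      sign R j s * sign R i (insert j s) * sign_mul_self (R := R) i s)
  · rw [if_neg hi, sub_zero]
    rw [sum_eq_single_of_mem i (by simpa using hi)]
    · rw [mulE_apply, if_pos (mem_insert_self i s), erase_insert hi, sign_insert_self hi, smul_smul]
      congr 1
      rw [mul_right_comm, sign_mul_self, one_mul]
    · intro j _ hji
      rw [mulE_apply, if_neg (by simp [hi, Ne.symm hji]), smul_zero]

/-- Every element of the ideal generated by the `x i` annihilates Koszul homology: on cycles, it
is null-homotopic through a map raising the homological degree by one. -/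
lemma exists_homotopy {x : σ → R} {f : R} (hf : f ∈ Ideal.span (Set.range x)) :
    ∃ h : (Finset σ → M) →ₗ[R] (Finset σ → M), (∀ z, d x z = 0 → d x (h z) = f • z) ∧
      ∀ z p, (∀ s : Finset σ, #s ≠ p → z s = 0) → ∀ s : Finset σ, #s ≠ p + 1 → h z s = 0 := by
  obtain ⟨c, rfl⟩ := (Submodule.mem_span_range_iff_exists_fun R).1 hf
  refine ⟨∑ i, c i • mulE R i, fun z hz => ?_, fun z p hz s hs => ?_⟩
  · simp [LinearMap.sum_apply, map_sum, d_mulE, hz, sum_smul, smul_smul]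
  · rw [LinearMap.sum_apply, Finset.sum_apply]
    refine sum_eq_zero fun i _ => ?_
    rw [LinearMap.smul_apply, Pi.smul_apply, mulE_apply]
    split_ifs with hi
    · rw [hz _ (fun h => hs ?_), smul_zero, smul_zero]
      rw [← h, card_erase_add_one hi]
    · rw [smul_zero]

/-- A chain of homological degree `p` that is a boundary is the boundary of a chain of
homological degree `p + 1`. -/
lemma exists_d_eq_of_degree {x : σ → R} {p : ℕ} {w z : Finset σ → M} (h : d x w = z)
    (hz : ∀ s : Finset σ, #s ≠ p → z s = 0) :
    ∃ w' : Finset σ → M, d x w' = z ∧ ∀ s : Finset σ, #s ≠ p + 1 → w' s = 0 := by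
  refine ⟨fun s => if #s = p + 1 then w s else 0, ?_, fun s hs => if_neg hs⟩
  ext s
  by_cases hs : #s = p
  · rw [← h, d_apply, d_apply]
    refine sum_congr rfl fun i hi => ?_
    rw [if_pos (by rw [card_insert_of_notMem (by simpa using hi), hs])]
  · rw [hz s hs, d_apply]
    refine sum_eq_zero fun i hi => ?_
    rw [if_neg (by rw [card_insert_of_notMem (by simpa using hi)]; omega), smul_zero]

variable {M' M'' : Type*} [AddCommGroup M'] [Module R M'] [AddCommGroup M''] [Module R M'']

lemma d_comp (x : σ → R) (φ : M →ₗ[R] M') (z : Finset σ → M) (s : Finset σ) :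
    d x (fun t => φ (z t)) s = φ (d x z s) := by
  simp [d_apply, map_sum]

/-- The Koszul homology of `x` with coefficients in `M` vanishes in homological degree `p`. -/
def AcyclicAt (x : σ → R) (M : Type*) [AddCommGroup M] [Module R M] (p : ℕ) : Prop :=
  ∀ z : Finset σ → M, (∀ s : Finset σ, #s ≠ p → z s = 0) → d x z = 0 →
    ∃ w : Finset σ → M, d x w = z

lemma AcyclicAt.of_card_lt (x : σ → R) {p : ℕ} (hp : Fintype.card σ < p) : AcyclicAt x M p :=
  fun z hz _ => ⟨0, by
    rw [map_zero]
    ext s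
    rw [hz s ((card_le_univ s).trans_lt hp).ne, Pi.zero_apply]⟩

/-- In a short exact sequence `0 → M' → M → M'' → 0`, Koszul acyclicity of `M` in degree `p + 1`
and of `M'` in degree `p` gives acyclicity of `M''` in degree `p + 1`. -/
lemma AcyclicAt.of_exact {x : σ → R} {p : ℕ} (i : M' →ₗ[R] M) (π : M →ₗ[R] M'')
    (hi : Function.Injective i) (hπ : Function.Surjective π) (hex : Function.Exact i π)
    (hM : AcyclicAt x M (p + 1)) (hM' : AcyclicAt x M' p) : AcyclicAt x M'' (p + 1) := by
  intro z hz hdz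
  have hlift : ∀ s, ∃ m, π m = z s ∧ (#s ≠ p + 1 → m = 0) := fun s => by
    by_cases hs : #s = p + 1
    · obtain ⟨m, hm⟩ := hπ (z s)
      exact ⟨m, hm, fun h => absurd hs h⟩
    · exact ⟨0, by rw [map_zero, hz s hs], fun _ => rfl⟩
  choose y hy hy0 using hlift
  have hker : ∀ s, ∃ m, i m = d x y s := fun s => by
    refine (hex _).1 ?_
    rw [← d_comp]
    simp only [hy]
    exact congrFun hdz s
  choose b hb using hker
  have hb' : (fun s => i (b s)) = d x y := funext hb
  have hbdeg : ∀ s : Finset σ, #s ≠ p → b s = 0 := fun s hs => hi (by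
    rw [hb, map_zero, d_apply]
    refine sum_eq_zero fun j hj => ?_
    rw [hy0 _ (by rw [card_insert_of_notMem (by simpa using hj)]; omega), smul_zero])
  obtain ⟨c, hc⟩ := hM' b hbdeg (by
    ext s
    refine hi ?_
    rw [← d_comp, hb', d_d, Pi.zero_apply, Pi.zero_apply, map_zero])
  -- correcting the lift `y` of `z` by a chain of `M'` makes it a cycle of `M`
  obtain ⟨c', hc', hc0⟩ := exists_d_eq_of_degree hc hbdeg
  obtain ⟨w, hw⟩ := hM (y - fun s => i (c' s))
    (fun s hs => by simp [hy0 s hs, hc0 s hs]) (by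
      ext s
      rw [map_sub, Pi.sub_apply, d_comp, hc', hb, sub_self, Pi.zero_apply])
  refine ⟨fun s => π (w s), ?_⟩
  ext s
  rw [d_comp, hw, Pi.sub_apply, map_sub, hy, hex.apply_apply_eq_zero, sub_zero]

/-- If `f` lies in the ideal generated by `x` and is `M`-regular with `M / f M ≅ M''`, then
nonvanishing of Koszul homology moves up by one degree from `M` to `M''`. -/
lemma AcyclicAt.of_isSMulRegular {x : σ → R} {f : R} (hf : f ∈ Ideal.span (Set.range x)) {p : ℕ}
    (hreg : IsSMulRegular M f) (π : M →ₗ[R] M'') (hπ : Function.Surjective π)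
    (hex : Function.Exact (f • LinearMap.id : M →ₗ[R] M) π) (h : AcyclicAt x M'' (p + 1)) :
    AcyclicAt x M p := by
  intro z hz hdz
  obtain ⟨H, hH, hHdeg⟩ := exists_homotopy (M := M) hf
  have hπf : ∀ m, π (f • m) = 0 := fun m => hex.apply_apply_eq_zero m
  obtain ⟨v, hv⟩ := h (fun s => π (H z s))
    (fun s hs => by rw [hHdeg z p hz s hs, map_zero]) (by
      ext s
      rw [d_comp, hH z hdz, Pi.smul_apply, hπf, Pi.zero_apply])
  choose v' hv' using fun s => hπ (v s)
  have hker : ∀ s, ∃ m, f • m = H z s - d x v' s := fun s => by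
    refine (hex _).1 ?_
    rw [map_sub, ← d_comp, ← congrFun hv s]
    simp only [hv', sub_self]
  -- `f z` is the boundary of `H z = d v' + f w`, so that `f z = f (d w)`
  choose w hw using hker
  refine ⟨w, ?_⟩
  ext s
  refine hreg ?_
  have h1 : f • w = H z - d x v' := funext hw
  change f • (d x w s) = f • z s
  rw [← Pi.smul_apply, ← map_smul, h1, map_sub, d_d, sub_zero, hH z hdz, Pi.smul_apply]

open RingTheory.Sequence Pointwise in
/-- Regular sequences in the ideal generated by `x` make the top Koszul homology vanish. -/
lemma AcyclicAt.of_isWeaklyRegular {x : σ → R} {p : ℕ} {rs : List R}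
    (hrs : ∀ r ∈ rs, r ∈ Ideal.span (Set.range x)) (hreg : IsWeaklyRegular M rs)
    (hp : Fintype.card σ < p + rs.length) : AcyclicAt x M p := by
  induction hreg using IsWeaklyRegular.recIterModByRegular generalizing p with
  | nil => exact of_card_lt x (by simpa using hp)
  | @cons M _ _ r rs h1 h2 ih =>
    refine of_isSMulRegular (hrs r (by simp)) h1 (Submodule.mkQ (r • (⊤ : Submodule R M)))
      (Submodule.mkQ_surjective _) ?_
      (ih (fun s hs => hrs s (List.mem_cons_of_mem _ hs)) (by simp at hp; omega))
    intro m
    rw [Submodule.mkQ_apply, Submodule.Quotient.mk_eq_zero, Submodule.mem_smul_pointwise_iff_exists]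
    simp

/-- If the Koszul homology in top degree `|σ|`, which is the submodule of `M` annihilated by all
`x i`, is zero, then some element of the ideal generated by `x` is `M`-regular. -/
lemma AcyclicAt.exists_isSMulRegular [IsNoetherianRing R] [Module.Finite R M] {x : σ → R}
    (h : AcyclicAt x M (Fintype.card σ)) :
    ∃ f ∈ Ideal.span (Set.range x), IsSMulRegular M f := by
  by_contra! hcon
  have hsub : ((Ideal.span (Set.range x) : Ideal R) : Set R) ⊆
      ⋃ P ∈ associatedPrimes R M, (P : Set R) := by
    rw [biUnion_associatedPrimes_eq_zero_divisors]
    intro f hf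
    have := hcon f hf
    rw [isSMulRegular_iff_right_eq_zero_of_smul] at this
    push Not at this
    obtain ⟨m, hm, hm0⟩ := this
    exact ⟨m, hm0, hm⟩
  obtain ⟨P, hP, hle⟩ := (Ideal.subset_union_prime_finite (associatedPrimes.finite R M)
    (f := id) 0 0 fun _ h _ _ => h.1).1 hsub
  rw [AssociatedPrimes.mem_iff, isAssociatedPrime_iff] at hP
  obtain ⟨hprime, m, hm⟩ := hP
  have hxm : ∀ i, x i • m = 0 := fun i => by
    have : x i ∈ P := hle (Ideal.subset_span ⟨i, rfl⟩)
    rw [hm, Submodule.mem_colon_singleton] at this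
    simpa using this
  obtain ⟨w, hw⟩ := h (fun s => if s = univ then m else 0)
    (fun s hs => if_neg fun h => hs (by rw [h, card_univ])) (by
      ext s
      rw [d_apply]
      refine sum_eq_zero fun i _ => ?_
      split_ifs
      · rw [mul_smul, hxm, smul_zero]
      · rw [smul_zero])
  have hm0 : m = 0 := by
    have := congrFun hw univ
    simpa [d_apply] using this.symm
  refine hprime.ne_top ?_
  rw [hm, hm0, Ideal.eq_top_iff_one, Submodule.mem_colon_singleton]
  simp

open RingTheory.Sequence Pointwise in
/-- Vanishing of the Koszul homology in the top `r` degrees produces a regular sequence of length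
`r` in the ideal generated by `x`. -/
lemma exists_isWeaklyRegular [IsNoetherianRing R] {x : σ → R} (r : ℕ) :
    ∀ (M : Type*) [AddCommGroup M] [Module R M] [Module.Finite R M],
    (∀ p, Fintype.card σ < p + r → AcyclicAt x M p) →
    r ≤ Fintype.card σ →
    ∃ rs : List R, (∀ f ∈ rs, f ∈ Ideal.span (Set.range x)) ∧ IsWeaklyRegular M rs ∧
      rs.length = r := by
  induction r with
  | zero => exact fun M _ _ _ _ _ => ⟨[], by simp⟩
  | succ r ih =>
    intro M _ _ _ h hr
    obtain ⟨f, hf, hreg⟩ := (h (Fintype.card σ) (by omega)).exists_isSMulRegular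
    obtain ⟨rs, hrs, hw, hlen⟩ := ih (QuotSMulTop f M) (fun p hp => by
      obtain ⟨p, rfl⟩ := Nat.exists_eq_add_of_lt (show 0 < p by omega)
      rw [zero_add]
      refine AcyclicAt.of_exact (M' := M) (M := M) (f • LinearMap.id)
        (Submodule.mkQ (f • (⊤ : Submodule R M))) (fun a b hab => hreg hab)
        (Submodule.mkQ_surjective _) ?_
        (h _ (by omega)) (h _ (by omega))
      intro m
      rw [Submodule.mkQ_apply, Submodule.Quotient.mk_eq_zero,
        Submodule.mem_smul_pointwise_iff_exists]
      simp) (by omega)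
    exact ⟨f :: rs, by simpa [hf] using hrs, .cons hreg hw, by simp [hlen]⟩

end Koszul

open MvPolynomial

/-! ### Linear quotients and linear resolutions -/

section LinearQuotients

variable {σ K : Type*} [Field K]

lemma mem_span_X_of_X_mul_mem {T : Set σ} {t : σ} (ht : t ∉ T) {f : MvPolynomial σ K}
    (h : X t * f ∈ Ideal.span ((X : σ → MvPolynomial σ K) '' T)) :
    f ∈ Ideal.span ((X : σ → MvPolynomial σ K) '' T) := by
  classical
  rw [mem_ideal_span_X_image] at h ⊢
  intro m hm
  obtain ⟨i, hi, hmi⟩ := h (Finsupp.single t 1 + m) (by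
    rw [mem_support_iff, coeff_X_mul]; exact mem_support_iff.1 hm)
  refine ⟨i, hi, ?_⟩
  have hit : t ≠ i := fun h => ht (h ▸ hi)
  simpa [Finsupp.single_apply, hit] using hmi

lemma homogeneousComponent_mul_of_isHomogeneous {g : MvPolynomial σ K} {e : ℕ}
    (hg : g.IsHomogeneous e) (c : MvPolynomial σ K) (d : ℕ) :
    homogeneousComponent (d + e) (c * g) = homogeneousComponent d c * g := by
  let _ : GradedAlgebra (homogeneousSubmodule σ K) := gradedAlgebra
  rw [← decomposition.decompose'_apply, ← decomposition.decompose'_apply]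
  exact DirectSum.coe_decompose_mul_add_of_right_mem (homogeneousSubmodule σ K)
    ((mem_homogeneousSubmodule e g).2 hg)

variable {E : Type*} [AddCommGroup E] [Module (MvPolynomial σ K) E]

/-- A set `D` of elements of a module behaves like the set of elements of one fixed degree: a
relation `X t • u = ∑ c j • g j` between elements of `D` stays valid when the coefficients `c j`
are replaced by their linear parts. -/
def IsDegreeSet (D : Set E) : Prop :=
  ∀ ⦃b : ℕ⦄ ⦃g : Fin b → E⦄ ⦃u : E⦄, (∀ j, g j ∈ D) → u ∈ D →
    ∀ (t : σ) (c : Fin b → MvPolynomial σ K), (X t : MvPolynomial σ K) • u = ∑ j, c j • g j →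
      (X t : MvPolynomial σ K) • u = ∑ j, homogeneousComponent 1 (c j) • g j

lemma isDegreeSet_isHomogeneous (d : ℕ) :
    IsDegreeSet (σ := σ) (K := K) {f : MvPolynomial σ K | f.IsHomogeneous d} := by
  intro b g u hg hu t c h
  have h' := congrArg (homogeneousComponent (1 + d)) h
  simp only [smul_eq_mul, map_sum] at h' ⊢
  rw [homogeneousComponent_mul_of_isHomogeneous hu,
    homogeneousComponent_of_mem (isHomogeneous_X K t),
    if_pos rfl] at h'
  rw [h']
  exact Finset.sum_congr rfl fun j _ => homogeneousComponent_mul_of_isHomogeneous (hg j) _ _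

lemma isDegreeSet_pi (d : ℕ) (ι : Type*) : IsDegreeSet (σ := σ) (K := K)
    {v : ι → MvPolynomial σ K | ∀ i, (v i).IsHomogeneous d} := by
  intro b g u hg hu t c h
  ext1 i
  have := isDegreeSet_isHomogeneous d (g := fun j => g j i) (fun j => hg j i) (hu i) t c
    (by simpa using congrFun h i)
  simpa using this

/-- The submodule `N` has linear quotients with respect to a sequence of generators in `D`: it is
built up from `0` by adjoining elements `u ∈ D` one at a time, each having a colon ideal generated
by a set of at most `q` variables. -/
inductive HasLinearFiltration (D : Set E) (q : ℕ) : Submodule (MvPolynomial σ K) E → Prop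
  | bot : HasLinearFiltration D q ⊥
  | sup_span {N : Submodule (MvPolynomial σ K) E} (u : E) (T : Finset σ)
      (hN : HasLinearFiltration D q N) (hu : u ∈ D) (hT : T.card ≤ q)
      (hcolon : N.colon {u} = Ideal.span ((X : σ → MvPolynomial σ K) '' T)) :
      HasLinearFiltration D q (N ⊔ Submodule.span (MvPolynomial σ K) {u})

lemma HasLinearFiltration.map {E' : Type*} [AddCommGroup E'] [Module (MvPolynomial σ K) E']
    {D : Set E} {D' : Set E'} {q : ℕ} {N : Submodule (MvPolynomial σ K) E}
    (h : HasLinearFiltration D q N) (φ : E →ₗ[MvPolynomial σ K] E')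
    (hφ : Function.Injective φ) (hD : ∀ u ∈ D, φ u ∈ D') :
    HasLinearFiltration D' q (N.map φ) := by
  induction h with
  | bot => rw [Submodule.map_bot]; exact .bot
  | @sup_span N u T _ hu hT hcolon ih =>
    rw [Submodule.map_sup, Submodule.map_span, Set.image_singleton]
    refine .sup_span _ T ih (hD u hu) hT ?_
    rw [← hcolon]
    ext r
    rw [Submodule.mem_colon_singleton, Submodule.mem_colon_singleton, ← map_smul]
    exact hφ.mem_set_image (s := (N : Set E))

/-- The embedding of `S ^ b` into `S ^ (b + 1)` as the vectors with first coordinate zero. -/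
def consZero (S : Type*) [CommRing S] (b : ℕ) : (Fin b → S) →ₗ[S] (Fin (b + 1) → S) where
  toFun v := Fin.cons 0 v
  map_add' v w := by ext i; refine Fin.cases ?_ (fun j => ?_) i <;> simp
  map_smul' r v := by ext i; refine Fin.cases ?_ (fun j => ?_) i <;> simp

lemma consZero_apply {S : Type*} [CommRing S] {b : ℕ} (v : Fin b → S) :
    consZero S b v = Fin.cons 0 v := rfl

lemma consZero_injective (S : Type*) [CommRing S] (b : ℕ) :
    Function.Injective (consZero S b) := fun v w h => by
  ext j
  simpa [consZero_apply] using congrFun h j.succ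

lemma linearCombination_cons {S E : Type*} [CommRing S] [AddCommGroup E] [Module S E] {b : ℕ}
    (u : E) (g : Fin b → E) (v : Fin (b + 1) → S) :
    Fintype.linearCombination S (Fin.cons u g : Fin (b + 1) → E) v =
      v 0 • u + Fintype.linearCombination S g (Fin.tail v) := by
  simp [Fintype.linearCombination_apply, Fin.sum_univ_succ, Fin.tail]

/-- The first syzygy module of a module with linear quotients again has linear quotients, with
respect to linear syzygies. If `u` is adjoined to generators `g` and `(N : u)` is generated by the
variables in `T`, then the syzygies of `g` together with one syzygy `X t • u = ∑ c j • g j` for each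
`t ∈ T` generate all syzygies, and the colon ideals of the new ones are generated by the
variables of the previously adjoined ones. -/
lemma HasLinearFiltration.exists_syzygies {D : Set E} {q : ℕ}
    {N : Submodule (MvPolynomial σ K) E} (hD : IsDegreeSet (σ := σ) (K := K) D)
    (h : HasLinearFiltration D q N) :
    ∃ (b : ℕ) (g : Fin b → E), (∀ j, g j ∈ D) ∧
      Submodule.span (MvPolynomial σ K) (Set.range g) = N ∧
      HasLinearFiltration {v : Fin b → MvPolynomial σ K | ∀ i, (v i).IsHomogeneous 1} q
        (LinearMap.ker (Fintype.linearCombination (MvPolynomial σ K) g)) := by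
  classical
  induction h with
  | bot =>
    refine ⟨0, Fin.elim0, fun j => j.elim0, by simp, ?_⟩
    rw [show LinearMap.ker (Fintype.linearCombination (MvPolynomial σ K) (Fin.elim0 : Fin 0 → E))
      = ⊥ from Subsingleton.elim _ _]
    exact .bot
  | @sup_span N u T hN hu hT hcolon ih =>
    obtain ⟨b, g, hg, hspan, hker⟩ := ih
    set S := MvPolynomial σ K
    have hmem : ∀ f : S, f ∈ Ideal.span ((X : σ → S) '' T) ↔ f • u ∈ N := fun f => by
      rw [← hcolon, Submodule.mem_colon_singleton]
    have hc : ∀ t : T, ∃ c : Fin b → S, (∀ j, (c j).IsHomogeneous 1) ∧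
        (X t.1 : S) • u = Fintype.linearCombination S g c := fun t => by
      have h1 : (X t.1 : S) • u ∈ N := (hmem _).1 (Ideal.subset_span ⟨t.1, t.2, rfl⟩)
      rw [← hspan, Submodule.mem_span_range_iff_exists_fun] at h1
      obtain ⟨c, hc⟩ := h1
      exact ⟨fun j => homogeneousComponent 1 (c j),
        fun j => homogeneousComponent_isHomogeneous 1 (c j), hD hg hu t.1 c hc.symm⟩
    choose c hclin hc using hc
    let s : σ → (Fin (b + 1) → S) := fun t => if h : t ∈ T then Fin.cons (X t) (-(c ⟨t, h⟩)) else 0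
    have hs : ∀ t (h : t ∈ T), s t = Fin.cons (X t) (-(c ⟨t, h⟩)) := fun t h => dif_pos h
    have hs0 : ∀ t ∈ T, s t 0 = X t := fun t h => by rw [hs t h, Fin.cons_zero]
    set A := (LinearMap.ker (Fintype.linearCombination S g)).map (consZero S b)
    -- the first coordinates of the vectors adjoined so far
    have hproj : ∀ T' ⊆ T, (A ⊔ Submodule.span S (s '' T')).map (LinearMap.proj 0) =
        Ideal.span ((X : σ → S) '' T') := fun T' hT' => by
      rw [Submodule.map_sup, Submodule.map_span, ← Submodule.map_comp,
        show (LinearMap.proj 0 : (Fin (b + 1) → S) →ₗ[S] S) ∘ₗ consZero S b = 0 by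
          ext; simp [consZero_apply], Submodule.map_zero, bot_sup_eq, Set.image_image]
      congr 1
      exact Set.image_congr fun t ht => hs0 t (hT' ht)
    have hfil : ∀ T' ⊆ T, HasLinearFiltration
        {v : Fin (b + 1) → S | ∀ i, (v i).IsHomogeneous 1} q (A ⊔ Submodule.span S (s '' T')) := by
      intro T'
      induction T' using Finset.induction_on with
      | empty =>
        intro _
        simp only [Finset.coe_empty, Set.image_empty, Submodule.span_empty, sup_bot_eq]
        refine hker.map _ (consZero_injective S b) fun v hv i => ?_
        refine Fin.cases ?_ (fun j => ?_) i
        · simpa [consZero_apply] using isHomogeneous_zero σ K 1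
        · simpa [consZero_apply] using hv j
      | insert t T' ht ih =>
        intro hT'
        rw [Finset.insert_subset_iff] at hT'
        rw [Finset.coe_insert, Set.image_insert_eq, Submodule.span_insert,
          sup_comm (Submodule.span S _),
          ← sup_assoc]
        refine .sup_span _ T' (ih hT'.2) (fun i => ?_) ((Finset.card_le_card hT'.2).trans hT) ?_
        · rw [hs t hT'.1]
          refine Fin.cases ?_ (fun j => ?_) i
          · simpa using isHomogeneous_X K t
          · simpa using (hclin ⟨t, hT'.1⟩ j).neg
        · refine le_antisymm (fun f hf => ?_) (Ideal.span_le.2 ?_)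
          · rw [Submodule.mem_colon_singleton] at hf
            refine mem_span_X_of_X_mul_mem (t := t) (by simpa using ht) ?_
            rw [← hproj T' hT'.2, mul_comm]
            refine ⟨f • s t, hf, ?_⟩
            simp [hs0 t hT'.1]
          · rintro _ ⟨t', ht', rfl⟩
            have ht'T := hT'.2 ht'
            rw [SetLike.mem_coe, Submodule.mem_colon_singleton]
            have heq : (X t' : S) • s t =
                consZero S b ((X t : S) • c ⟨t', ht'T⟩ - (X t' : S) • c ⟨t, hT'.1⟩) +
                  (X t : S) • s t' := by
              rw [hs t hT'.1, hs t' ht'T, consZero_apply]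
              refine funext fun i => Fin.cases ?_ (fun j => ?_) i
              · simp [mul_comm]
              · simp only [Pi.smul_apply, Pi.add_apply, Pi.sub_apply, Pi.neg_apply, Fin.cons_succ,
                  smul_eq_mul]
                ring
            rw [heq]
            refine Submodule.add_mem_sup (Submodule.mem_map_of_mem ?_)
              (Submodule.smul_mem _ _ (Submodule.subset_span ⟨t', ht', rfl⟩))
            rw [LinearMap.mem_ker, map_sub, map_smul, map_smul, ← hc, ← hc, smul_smul, smul_smul,
              mul_comm, sub_self]
    refine ⟨b + 1, Fin.cons u g, fun j => ?_, ?_, ?_⟩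
    · refine Fin.cases hu hg j
    · rw [Fin.range_cons, Submodule.span_insert, hspan, sup_comm]
    · convert hfil T subset_rfl using 1
      have hle : A ⊔ Submodule.span S (s '' T) ≤
          LinearMap.ker (Fintype.linearCombination S (Fin.cons u g : Fin (b + 1) → E)) := by
        refine sup_le ?_ (Submodule.span_le.2 ?_)
        · rintro _ ⟨v, hv, rfl⟩
          rw [LinearMap.mem_ker, linearCombination_cons, consZero_apply, Fin.cons_zero, zero_smul,
            zero_add, Fin.tail_cons]
          exact hv
        · rintro _ ⟨t, ht, rfl⟩
          rw [SetLike.mem_coe, LinearMap.mem_ker, linearCombination_cons, hs t ht, Fin.cons_zero,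
            Fin.tail_cons, map_neg, ← hc, add_neg_cancel]
      -- subtract from a syzygy a combination of the `s t` with the same first coordinate
      refine le_antisymm (fun v hv => ?_) hle
      have hv0 : v 0 ∈ Ideal.span ((X : σ → S) '' T) := by
        rw [hmem, ← hspan]
        rw [LinearMap.mem_ker, linearCombination_cons] at hv
        rw [eq_neg_of_add_eq_zero_left hv, Submodule.neg_mem_iff,
          ← Fintype.range_linearCombination]
        exact ⟨_, rfl⟩
      rw [← hproj T subset_rfl] at hv0
      obtain ⟨w, hw, hwv⟩ := hv0
      rw [← sub_add_cancel v w]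
      refine Submodule.add_mem _ (Submodule.mem_sup_left ⟨Fin.tail (v - w), ?_, ?_⟩) hw
      · have hvw : (v - w) 0 = 0 := by
          rw [Pi.sub_apply, sub_eq_zero]; exact hwv.symm
        have := Submodule.sub_mem _ hv (hle hw)
        rw [LinearMap.mem_ker, linearCombination_cons, hvw, zero_smul, zero_add] at this
        exact this
      · rw [consZero_apply]
        have hvw : (v - w) 0 = 0 := by
          rw [Pi.sub_apply, sub_eq_zero]; exact hwv.symm
        rw [← hvw, Fin.cons_self_tail]

/-- Iterating the passage to syzygies resolves an ideal with linear quotients by linear maps. -/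
lemma HasLinearFiltration.hasLinearResolution {d q : ℕ} {I : Ideal (MvPolynomial σ K)}
    (h : HasLinearFiltration {f : MvPolynomial σ K | f.IsHomogeneous d} q I) :
    HasLinearResolution I := by
  obtain ⟨b₀, g, hg, hspan, hker⟩ := h.exists_syzygies (isDegreeSet_isHomogeneous d)
  have step : ∀ (b : ℕ) (N : Submodule (MvPolynomial σ K) (Fin b → MvPolynomial σ K)),
      HasLinearFiltration {v | ∀ i, (v i).IsHomogeneous 1} q N →
      ∃ (b' : ℕ) (A : Matrix (Fin b) (Fin b') (MvPolynomial σ K)),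
        (∀ r c, (A r c).IsHomogeneous 1) ∧ LinearMap.range A.mulVecLin = N ∧
        HasLinearFiltration {v | ∀ i, (v i).IsHomogeneous 1} q (LinearMap.ker A.mulVecLin) := by
    intro b N hN
    obtain ⟨b', g, hg, hspan, hker⟩ := hN.exists_syzygies (isDegreeSet_pi 1 (Fin b))
    have hA : (Matrix.of fun r c => g c r).mulVecLin =
        Fintype.linearCombination (MvPolynomial σ K) g := by
      ext1 v
      ext r
      simp [Matrix.mulVec, dotProduct, Fintype.linearCombination_apply, mul_comm]
    refine ⟨b', Matrix.of fun r c => g c r, fun r c => hg c r, ?_, ?_⟩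
    · rw [hA, Fintype.range_linearCombination, hspan]
    · rwa [hA]
  choose b' A hlin hrange hker' using step
  let st : ℕ → Σ b : ℕ, {N : Submodule (MvPolynomial σ K) (Fin b → MvPolynomial σ K) //
      HasLinearFiltration {v | ∀ i, (v i).IsHomogeneous 1} q N} := fun i =>
    Nat.rec ⟨b₀, _, hker⟩ (fun _ s => ⟨b' s.1 s.2.1 s.2.2, _, hker' s.1 s.2.1 s.2.2⟩) i
  refine ⟨d, fun i => (st i).1, g, fun i => A (st i).1 (st i).2.1 (st i).2.2, hg,
    fun i => hlin _ _ _, hspan, ?_, fun i => ?_⟩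
  · rw [LinearMap.exact_iff]
    exact (hrange _ _ (st 0).2.2).symm
  · rw [LinearMap.exact_iff]
    exact (hrange _ _ (st (i + 1)).2.2).symm

/-! ### Koszul homology of quotients by ideals with linear quotients -/

section Koszul

variable [Fintype σ] [LinearOrder σ]

open Koszul

/-- The variables outside `T` form a regular sequence modulo those in `T`, which forces the
Koszul homology to vanish above degree `|T|`. -/
lemma acyclicAt_quotient_span_X {p : ℕ} (T : Finset σ) (hp : T.card < p) :
    AcyclicAt (X : σ → MvPolynomial σ K)
      (MvPolynomial σ K ⧸ Ideal.span ((X : σ → MvPolynomial σ K) '' T)) p := by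
  induction h : Tᶜ.card generalizing T p with
  | zero =>
    rw [Finset.card_compl] at h
    exact .of_card_lt _ (by omega)
  | succ n ih =>
    obtain ⟨v, hv⟩ : Tᶜ.Nonempty := Finset.card_pos.1 (by omega)
    rw [Finset.mem_compl] at hv
    have hle : Ideal.span ((X : σ → MvPolynomial σ K) '' T) ≤
        Ideal.span ((X : σ → MvPolynomial σ K) '' (insert v T : Finset σ)) :=
      Ideal.span_mono (Set.image_mono (by simp))
    have hcard : (insert v T)ᶜ.card = n := by
      rw [Finset.card_compl, Finset.card_insert_of_notMem hv]
      rw [Finset.card_compl] at h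
      omega
    refine .of_isSMulRegular (f := X v) (Ideal.subset_span ⟨v, rfl⟩) ?_ (Submodule.factor hle)
      (Submodule.factor_surjective hle) ?_
      (ih (insert v T) (by rw [Finset.card_insert_of_notMem hv]; omega) hcard)
    · rw [isSMulRegular_iff_right_eq_zero_of_smul]
      intro m hm
      obtain ⟨f, rfl⟩ := Submodule.mkQ_surjective _ m
      rw [← map_smul, Submodule.mkQ_apply, Submodule.Quotient.mk_eq_zero] at hm
      rw [Submodule.mkQ_apply, Submodule.Quotient.mk_eq_zero]
      exact mem_span_X_of_X_mul_mem (by simpa using hv) hm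
    · intro m
      obtain ⟨f, rfl⟩ := Submodule.mkQ_surjective _ m
      rw [Submodule.factor_mk, Submodule.mkQ_apply, Submodule.mkQ_apply,
        Submodule.Quotient.mk_eq_zero,
        Finset.coe_insert, Set.image_insert_eq, Ideal.mem_span_insert]
      constructor
      · rintro ⟨a, z, hz, rfl⟩
        refine ⟨Submodule.mkQ _ a, ?_⟩
        rw [LinearMap.smul_apply, LinearMap.id_apply, Submodule.mkQ_apply,
          ← Submodule.Quotient.mk_smul, Submodule.Quotient.eq, smul_eq_mul, mul_comm,
          sub_add_cancel_left, Submodule.neg_mem_iff]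
        exact hz
      · rintro ⟨a, ha⟩
        obtain ⟨a, rfl⟩ := Submodule.mkQ_surjective _ a
        rw [LinearMap.smul_apply, LinearMap.id_apply, Submodule.mkQ_apply,
          ← Submodule.Quotient.mk_smul, eq_comm, Submodule.Quotient.eq] at ha
        exact ⟨a, _, ha, by rw [smul_eq_mul, mul_comm]; ring⟩

/-- The Koszul homology of `S / I` vanishes above degree `q + 1` when `I` has linear quotients whose
colon ideals are generated by at most `q` variables. -/
lemma HasLinearFiltration.acyclicAt {D : Set (MvPolynomial σ K)} {q p : ℕ}
    {I : Ideal (MvPolynomial σ K)} (h : HasLinearFiltration D q I) (hp : q + 1 < p) :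
    AcyclicAt (X : σ → MvPolynomial σ K) (MvPolynomial σ K ⧸ I) p := by
  induction h with
  | bot =>
    have := acyclicAt_quotient_span_X (K := K) (∅ : Finset σ) (p := p) (by simp; omega)
    rwa [Finset.coe_empty, Set.image_empty, Ideal.span_empty] at this
  | @sup_span N u T _ hu hT hcolon ih =>
    obtain ⟨p, rfl⟩ := Nat.exists_eq_add_of_lt (show 0 < p by omega)
    rw [zero_add] at ih ⊢
    have hT' := acyclicAt_quotient_span_X (K := K) T (p := p) (by omega)
    rw [← hcolon] at hT'
    have hmap : N.colon {u} ≤ N.comap (LinearMap.toSpanSingleton (MvPolynomial σ K) _ u) :=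
      fun f hf => by simpa [Submodule.mem_colon_singleton] using hf
    refine .of_exact (Submodule.mapQ _ _ (LinearMap.toSpanSingleton _ _ u) hmap)
      (Submodule.factor (le_sup_left : N ≤ N ⊔ Submodule.span (MvPolynomial σ K) {u})) ?_
      (Submodule.factor_surjective _) ?_ ih hT'
    · rw [injective_iff_map_eq_zero]
      intro m hm
      obtain ⟨f, rfl⟩ := Submodule.mkQ_surjective _ m
      rw [Submodule.mkQ_apply, Submodule.mapQ_apply, Submodule.Quotient.mk_eq_zero] at hm
      rw [Submodule.mkQ_apply, Submodule.Quotient.mk_eq_zero, Submodule.mem_colon_singleton]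
      exact hm
    · intro m
      obtain ⟨f, rfl⟩ := Submodule.mkQ_surjective _ m
      rw [Submodule.factor_mk, Submodule.mkQ_apply, Submodule.mkQ_apply,
        Submodule.Quotient.mk_eq_zero,
        Submodule.mem_sup]
      constructor
      · rintro ⟨z, hz, _, hw, rfl⟩
        obtain ⟨a, rfl⟩ := Submodule.mem_span_singleton.1 hw
        refine ⟨Submodule.Quotient.mk a, ?_⟩
        rw [Submodule.mapQ_apply, Submodule.Quotient.eq, LinearMap.toSpanSingleton_apply,
          sub_add_cancel_right, Submodule.neg_mem_iff]
        exact hz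
      · rintro ⟨a, ha⟩
        obtain ⟨a, rfl⟩ := Submodule.mkQ_surjective _ a
        rw [Submodule.mkQ_apply, Submodule.mapQ_apply, eq_comm, Submodule.Quotient.eq,
          LinearMap.toSpanSingleton_apply] at ha
        exact ⟨_, ha, _, Submodule.mem_span_singleton.2 ⟨a, rfl⟩, sub_add_cancel _ _⟩

end Koszul

end LinearQuotients

/-! ### The generators of the powers of the cover ideal -/

section Combinatorics

variable {n : ℕ}

lemma forall_whiskerVertex {P : WhiskerVertex n → Prop} :
    (∀ v, P v) ↔ ∀ i, P (xVertex i) ∧ P (yVertex i) := by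
  refine ⟨fun h i => ⟨h _, h _⟩, fun h v => ?_⟩
  match v with
  | (i, 0) => exact (h i).1
  | (i, 1) => exact (h i).2

lemma xVertex_injective : Function.Injective (xVertex : Fin n → WhiskerVertex n) :=
  fun _ _ h => congrArg (fun p => (ofLex p).1) h

lemma yVertex_injective : Function.Injective (yVertex : Fin n → WhiskerVertex n) :=
  fun _ _ h => congrArg (fun p => (ofLex p).1) h

lemma xVertex_ne_yVertex (i j : Fin n) : xVertex i ≠ yVertex j :=
  fun h => absurd (congrArg (fun p => (ofLex p).2) h) (by decide : (0 : Fin 2) ≠ 1)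

lemma xVertex_lt_xVertex {i j : Fin n} : xVertex i < xVertex j ↔ i < j := by
  simp [xVertex, Prod.Lex.toLex_lt_toLex]

lemma xVertex_lt_yVertex {i j : Fin n} : xVertex i < yVertex j ↔ i ≤ j := by
  simp [xVertex, yVertex, Prod.Lex.toLex_lt_toLex, le_iff_lt_or_eq]

lemma yVertex_lt_xVertex {i j : Fin n} : yVertex i < xVertex j ↔ i < j := by
  simp [xVertex, yVertex, Prod.Lex.toLex_lt_toLex]

/-- The exponent vector with entries `a i` at `x_i` and `b i` at `y_i`. -/
def pairExponent (a b : Fin n → ℕ) : WhiskerVertex n →₀ ℕ :=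
  Finsupp.equivFunOnFinite.symm fun v => if (ofLex v).2 = 0 then a (ofLex v).1 else b (ofLex v).1

@[simp] lemma pairExponent_xVertex (a b : Fin n → ℕ) (i : Fin n) :
    pairExponent a b (xVertex i) = a i := rfl

@[simp] lemma pairExponent_yVertex (a b : Fin n → ℕ) (i : Fin n) :
    pairExponent a b (yVertex i) = b i := rfl

lemma exponent_ext {u v : WhiskerVertex n →₀ ℕ}
    (hx : ∀ i, u (xVertex i) = v (xVertex i)) (hy : ∀ i, u (yVertex i) = v (yVertex i)) : u = v :=
  Finsupp.ext (forall_whiskerVertex.2 fun i => ⟨hx i, hy i⟩)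

lemma pairExponent_add (a b a' b' : Fin n → ℕ) :
    pairExponent a b + pairExponent a' b' = pairExponent (a + a') (b + b') :=
  exponent_ext (fun _ => rfl) fun _ => rfl

lemma pairExponent_add_single_xVertex (a b : Fin n → ℕ) (i : Fin n) :
    pairExponent a b + Finsupp.single (xVertex i) 1 = pairExponent (a + Pi.single i 1) b := by
  refine exponent_ext (fun j => ?_) fun j => ?_
  · by_cases h : i = j
    · simp [h]
    · simp [h, xVertex_injective.ne h]
  · simp [xVertex_ne_yVertex]

lemma pairExponent_add_single_yVertex (a b : Fin n → ℕ) (i : Fin n) :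
    pairExponent a b + Finsupp.single (yVertex i) 1 = pairExponent a (b + Pi.single i 1) := by
  refine exponent_ext (fun j => ?_) fun j => ?_
  · simp [(xVertex_ne_yVertex _ _).symm]
  · by_cases h : i = j
    · simp [h]
    · simp [h, yVertex_injective.ne h]

lemma sum_whiskerVertex {α : Type*} [AddCommMonoid α] (f : WhiskerVertex n → α) :
    ∑ v, f v = ∑ i, (f (xVertex i) + f (yVertex i)) := by
  rw [← Equiv.sum_comp toLex f, Fintype.sum_prod_type]
  exact Finset.sum_congr rfl fun i _ => Fin.sum_univ_two _

lemma degree_pairExponent (a b : Fin n → ℕ) :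
    (pairExponent a b).degree = ∑ i, (a i + b i) := by
  rw [Finsupp.degree_eq_sum, sum_whiskerVertex]
  rfl

/-- The exponent vector of `∏ x_i ^ (a i) * y_i ^ (k - a i)`. -/
def coverExponent (k : ℕ) (a : Fin n → ℕ) : WhiskerVertex n →₀ ℕ :=
  pairExponent a fun i => k - a i

lemma degree_coverExponent {k : ℕ} {a : Fin n → ℕ} (ha : ∀ i, a i ≤ k) :
    (coverExponent k a).degree = n * k := by
  rw [coverExponent, degree_pairExponent,
    Finset.sum_congr rfl fun i _ => Nat.add_sub_cancel' (ha i)]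
  simp

variable (H : SimpleGraph (Fin n))

/-- `a` is the sum of the indicator functions of `k` vertex covers of `H`. -/
inductive IsCoverSum : ℕ → (Fin n → ℕ) → Prop
  | zero : IsCoverSum 0 0
  | add {k : ℕ} {a : Fin n → ℕ} {C : Finset (Fin n)} (ha : IsCoverSum k a)
      (hC : H.IsVertexCover (C : Set (Fin n))) :
      IsCoverSum (k + 1) (a + fun i => if i ∈ C then 1 else 0)

variable {H}

lemma IsCoverSum.le {k : ℕ} {a : Fin n → ℕ} (h : IsCoverSum H k a) (i : Fin n) : a i ≤ k := by
  induction h with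
  | zero => exact le_rfl
  | add _ _ ih =>
    rw [Pi.add_apply]
    split_ifs <;> omega

/-- Cover sums are closed under increasing an entry below the bound `k`: some of the `k` covers
misses the vertex `i`, and may be enlarged by it. -/
lemma IsCoverSum.add_single {k : ℕ} {a : Fin n → ℕ} (h : IsCoverSum H k a) {i : Fin n}
    (hi : a i < k) : IsCoverSum H k (a + Pi.single i 1) := by
  induction h with
  | zero => exact absurd hi (by simp)
  | @add k a C ha hC ih =>
    by_cases hik : a i < k
    · rw [add_right_comm]
      exact .add (ih hik) hC
    · have hiC : i ∉ C := fun hiC => by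
        rw [Pi.add_apply, if_pos hiC] at hi; omega
      have hC' : H.IsVertexCover ((insert i C : Finset (Fin n)) : Set (Fin n)) :=
        fun v w hvw => (hC hvw).imp (fun h => by simp [Finset.mem_coe.1 h])
          fun h => by simp [Finset.mem_coe.1 h]
      convert IsCoverSum.add ha hC' using 1
      rw [add_assoc]
      congr 1
      ext j
      by_cases hj : j = i
      · subst hj; simp [hiC]
      · simp [hj]

lemma IsCoverSum.add_one {k : ℕ} {a : Fin n → ℕ} (h : IsCoverSum H k a) :
    IsCoverSum H (k + 1) (a + 1) := by
  convert IsCoverSum.add h (C := Finset.univ) (by simp) using 1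
  ext j
  simp

lemma IsCoverSum.of_const (k : ℕ) : IsCoverSum H k (fun _ => k) := by
  induction k with
  | zero => exact .zero
  | succ k ih => exact ih.add_one

lemma finite_isCoverSum (k : ℕ) : {a | IsCoverSum H k a}.Finite :=
  (Set.finite_Iic (fun _ : Fin n => k)).subset fun _ ha => ha.le

variable (H) in
/-- The exponent vectors of the minimal generators of the `k`-th power of the cover ideal. -/
def coverGenerators (k : ℕ) : Set (WhiskerVertex n →₀ ℕ) :=
  coverExponent k '' {a | IsCoverSum H k a}

/-- A minimal vertex cover of the whisker graph contains exactly one endpoint of each whisker, and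
its vertices among the `x_i` form an arbitrary vertex cover of `H`. -/
lemma isMinimalVertexCover_whiskerGraph {C : Finset (WhiskerVertex n)} :
    IsMinimalVertexCover (whiskerGraph H) C ↔
      ∃ D : Finset (Fin n), H.IsVertexCover (D : Set (Fin n)) ∧
        ∀ i, (xVertex i ∈ C ↔ i ∈ D) ∧ (yVertex i ∈ C ↔ i ∉ D) := by
  classical
  have hxy : ∀ i, (whiskerGraph H).Adj (xVertex i) (yVertex i) :=
    fun i => Or.inr ⟨i, Or.inl ⟨rfl, rfl⟩⟩
  have hxx : ∀ {i j}, H.Adj i j → (whiskerGraph H).Adj (xVertex i) (xVertex j) :=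
    fun h => Or.inl ⟨_, _, h, rfl, rfl⟩
  constructor
  · intro h
    refine ⟨Finset.univ.filter fun i => xVertex i ∈ C, fun i j hij => ?_, fun i => ⟨by simp, ?_⟩⟩
    · simpa using h.1 (hxx hij)
    · simp only [Finset.mem_filter, Finset.mem_univ, true_and]
      refine ⟨fun hy hx => ?_, fun hx => ?_⟩
      · have hcov : (whiskerGraph H).IsVertexCover ((C.erase (yVertex i) : Finset _) : Set _) := by
          rintro v w hvw
          have := h.1 hvw
          simp only [Finset.coe_erase, Set.mem_sdiff, Finset.mem_coe,
            Set.mem_singleton_iff] at this ⊢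
          rcases hvw with ⟨j, l, -, rfl, rfl⟩ | ⟨j, ⟨rfl, rfl⟩ | ⟨rfl, rfl⟩⟩
          · simpa [xVertex_ne_yVertex] using this
          · by_cases hji : j = i
            · subst hji; exact Or.inl ⟨hx, xVertex_ne_yVertex _ _⟩
            · simpa [xVertex_ne_yVertex, yVertex_injective.ne hji] using this
          · by_cases hji : j = i
            · subst hji; exact Or.inr ⟨hx, xVertex_ne_yVertex _ _⟩
            · simpa [xVertex_ne_yVertex, yVertex_injective.ne hji] using this
        exact Finset.notMem_erase (yVertex i) C (h.2 hcov (Finset.erase_subset _ _) hy)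
      · exact (h.1 (hxy i)).resolve_left hx
  · rintro ⟨D, hD, hC⟩
    refine ⟨?_, fun E hE hEC v => ?_⟩
    · rintro v w (⟨i, j, hij, rfl, rfl⟩ | ⟨i, ⟨rfl, rfl⟩ | ⟨rfl, rfl⟩⟩)
      · simpa [(hC _).1] using hD hij
      · simpa [(hC i).1, (hC i).2] using em (i ∈ D)
      · simpa [(hC i).1, (hC i).2] using (em (i ∈ D)).symm
    · revert v
      rw [forall_whiskerVertex]
      refine fun i => ⟨fun hv => (hE (hxy i)).resolve_right fun h => ?_,
        fun hv => (hE (hxy i)).resolve_left fun h => ?_⟩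
      · exact (hC i).2.1 (hEC h) ((hC i).1.1 hv)
      · exact (hC i).2.1 hv ((hC i).1.1 (hEC h))

variable (K : Type*) [Field K]

lemma prod_X_eq_monomial {C : Finset (WhiskerVertex n)} {D : Finset (Fin n)}
    (h : ∀ i, (xVertex i ∈ C ↔ i ∈ D) ∧ (yVertex i ∈ C ↔ i ∉ D)) :
    ∏ v ∈ C, (X v : MvPolynomial (WhiskerVertex n) K) =
      monomial (coverExponent 1 (0 + fun i => if i ∈ D then 1 else 0)) 1 := by
  classical
  have he : ∀ v, coverExponent 1 (0 + fun i => if i ∈ D then 1 else 0) v =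
      if v ∈ C then 1 else 0 := by
    rw [forall_whiskerVertex]
    intro i
    rw [if_congr (h i).1 rfl rfl, if_congr (h i).2 rfl rfl]
    by_cases hi : i ∈ D <;> simp [coverExponent, hi]
  rw [monomial_eq, Finsupp.prod_fintype _ _ (by simp), C_1, one_mul, ← Finset.prod_ite_mem_eq]
  refine Finset.prod_congr rfl fun v _ => ?_
  rw [he v]
  split_ifs <;> simp

variable (H)

lemma coverIdeal_whiskerGraph : coverIdeal K (whiskerGraph H) =
    Ideal.span ((fun u => monomial u (1 : K)) '' coverGenerators H 1) := by
  classical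
  rw [coverIdeal]
  congr 1
  ext p
  constructor
  · rintro ⟨C, hC, rfl⟩
    obtain ⟨D, hD, hCD⟩ := isMinimalVertexCover_whiskerGraph.1 hC
    exact ⟨_, ⟨_, .add .zero hD, rfl⟩, (prod_X_eq_monomial K hCD).symm⟩
  · rintro ⟨_, ⟨a, ha, rfl⟩, rfl⟩
    rcases ha with _ | @⟨_, a, D, ha, hD⟩
    cases ha
    have hCD : ∀ i, (xVertex i ∈ D.image xVertex ∪ Dᶜ.image yVertex ↔ i ∈ D) ∧
        (yVertex i ∈ D.image xVertex ∪ Dᶜ.image yVertex ↔ i ∉ D) := fun i => by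
      simp [xVertex_injective.eq_iff, yVertex_injective.eq_iff, xVertex_ne_yVertex,
        (xVertex_ne_yVertex _ _).symm]
    exact ⟨_, isMinimalVertexCover_whiskerGraph.2 ⟨D, hD, hCD⟩, (prod_X_eq_monomial K hCD).symm⟩

lemma coverIdeal_pow (k : ℕ) : coverIdeal K (whiskerGraph H) ^ k =
    Ideal.span ((fun u => monomial u (1 : K)) '' coverGenerators H k) := by
  have hadd : ∀ {k a} {C : Finset (Fin n)}, IsCoverSum H k a →
      coverExponent k a + coverExponent 1 (0 + fun i => if i ∈ C then 1 else 0) =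
        coverExponent (k + 1) (a + fun i => if i ∈ C then 1 else 0) := by
    intro k a C ha
    rw [coverExponent, coverExponent, pairExponent_add, zero_add, coverExponent]
    congr 1
    ext i
    have := ha.le i
    simp only [Pi.add_apply]
    split_ifs <;> omega
  induction k with
  | zero =>
    rw [pow_zero, Ideal.one_eq_top, eq_comm, Ideal.eq_top_iff_one]
    refine Ideal.subset_span ⟨_, ⟨0, .zero, rfl⟩, ?_⟩
    have : coverExponent 0 (0 : Fin n → ℕ) = 0 := exponent_ext (fun _ => rfl) fun _ => rfl
    simp [this]
  | succ k ih =>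
    rw [pow_succ, ih, coverIdeal_whiskerGraph, Ideal.span_mul_span']
    congr 1
    ext p
    rw [Set.mem_mul]
    constructor
    · rintro ⟨_, ⟨_, ⟨a, ha, rfl⟩, rfl⟩, _, ⟨_, ⟨b, hb, rfl⟩, rfl⟩, rfl⟩
      rcases hb with _ | @⟨_, b, C, hb, hC⟩
      cases hb
      refine ⟨_, ⟨_, IsCoverSum.add ha hC, rfl⟩, ?_⟩
      simp only [monomial_mul, one_mul]
      rw [hadd ha]
    · rintro ⟨_, ⟨a, ha, rfl⟩, rfl⟩
      rcases ha with _ | @⟨_, a, C, ha, hC⟩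
      refine ⟨_, ⟨_, ⟨a, ha, rfl⟩, rfl⟩, _, ⟨_, ⟨_, .add .zero hC, rfl⟩, rfl⟩, ?_⟩
      simp only [monomial_mul, one_mul]
      rw [hadd ha]

variable {K H}

lemma monomial_mem_coverIdeal_pow {k : ℕ} {b : WhiskerVertex n →₀ ℕ} :
    monomial b (1 : K) ∈ coverIdeal K (whiskerGraph H) ^ k ↔
      ∃ a, IsCoverSum H k a ∧ coverExponent k a ≤ b := by
  classical
  rw [coverIdeal_pow, mem_ideal_span_monomial_image, support_monomial, if_neg one_ne_zero]
  simp [coverGenerators]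

lemma coverExponent_injOn_le {k : ℕ} {a a' : Fin n → ℕ} (ha : ∀ i, a i ≤ k)
    (h : coverExponent k a' ≤ coverExponent k a) : a' = a := by
  ext i
  have hx : a' i ≤ a i := h (xVertex i)
  have hy : k - a' i ≤ k - a i := h (yVertex i)
  have := ha i
  omega

lemma minimalGenerators_coverIdeal_pow (k : ℕ) :
    minimalGenerators (coverIdeal K (whiskerGraph H) ^ k) = coverGenerators H k := by
  ext b
  simp only [minimalGenerators, Set.mem_ofPred_eq, monomial_mem_coverIdeal_pow]
  constructor
  · rintro ⟨⟨a, ha, hab⟩, hmin⟩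
    exact ⟨a, ha, le_antisymm hab (hmin ⟨a, ha, le_rfl⟩ hab)⟩
  · rintro ⟨a, ha, rfl⟩
    refine ⟨⟨a, ha, le_rfl⟩, ?_⟩
    rintro c ⟨a', ha', hac⟩ hca
    rwa [← coverExponent_injOn_le ha.le (hac.trans hca)]

/-- The vertices `x_i` with `a i < k`. -/
def freeVertices (k : ℕ) (a : Fin n → ℕ) : Finset (WhiskerVertex n) :=
  (Finset.univ.filter fun i => a i < k).map ⟨xVertex, xVertex_injective⟩

lemma mem_freeVertices {k : ℕ} {a : Fin n → ℕ} {v : WhiskerVertex n} :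
    v ∈ freeVertices k a ↔ ∃ i, a i < k ∧ xVertex i = v := by
  simp [freeVertices]

lemma card_freeVertices (k : ℕ) (a : Fin n → ℕ) :
    (freeVertices k a).card = (Finset.univ.filter fun i => a i < k).card :=
  Finset.card_map _

/-- The lexicographic comparison of two generators of the same power is decided at a vertex `x_i`,
because the exponents of the `y_i` are determined by those of the `x_i`. -/
lemma exists_lt_of_coverExponent_lt {k : ℕ} {a b : Fin n → ℕ}
    (h : MonomialOrder.lex.toSyn (coverExponent k a) <
      MonomialOrder.lex.toSyn (coverExponent k b)) :
    ∃ i, a i < b i := by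
  rw [MonomialOrder.lex_lt_iff, Finsupp.Lex.lt_iff] at h
  obtain ⟨v, heq, hlt⟩ := h
  revert v
  rw [forall_whiskerVertex]
  refine fun i => ⟨fun _ h => ⟨i, h⟩, fun heq hlt => ?_⟩
  have h1 : a i = b i := heq (xVertex i) (xVertex_lt_yVertex.2 le_rfl)
  have h2 : k - a i < k - b i := hlt
  omega

lemma coverExponent_lt_add_single {k : ℕ} (a : Fin n → ℕ) (i : Fin n) :
    MonomialOrder.lex.toSyn (coverExponent k a) <
      MonomialOrder.lex.toSyn (coverExponent k (a + Pi.single i 1)) := by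
  rw [MonomialOrder.lex_lt_iff, Finsupp.Lex.lt_iff]
  refine ⟨xVertex i, ?_, ?_⟩
  · rw [forall_whiskerVertex]
    refine fun j => ⟨fun hj => ?_, fun hj => ?_⟩
    · have hji := (xVertex_lt_xVertex.1 hj).ne
      simp [coverExponent, hji]
    · have hji := (yVertex_lt_xVertex.1 hj).ne
      simp [coverExponent, hji]
  · simp [coverExponent]

/-- The colon ideal of a generator `u = ∏ x_i ^ (a i) * y_i ^ (k - a i)` with respect to the
lexicographically larger generators is generated by the `x_i` with `a i < k`. A larger generator
has a larger exponent at some such `x_i`; conversely `x_i u / y_i` is a larger generator. -/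
lemma colon_coverGenerators {k : ℕ} {a : Fin n → ℕ} (ha : IsCoverSum H k a) :
    (Ideal.span ((fun u => monomial u (1 : K)) '' {v | v ∈ coverGenerators H k ∧
        MonomialOrder.lex.toSyn (coverExponent k a) < MonomialOrder.lex.toSyn v})).colon
      {monomial (coverExponent k a) (1 : K)} =
    Ideal.span ((X : WhiskerVertex n → MvPolynomial (WhiskerVertex n) K) ''
      (freeVertices k a : Finset (WhiskerVertex n))) := by
  classical
  have key : ∀ m : WhiskerVertex n →₀ ℕ,
      (∃ v ∈ {v | v ∈ coverGenerators H k ∧ MonomialOrder.lex.toSyn (coverExponent k a) <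
        MonomialOrder.lex.toSyn v}, v ≤ m + coverExponent k a) ↔
      ∃ v ∈ (freeVertices k a : Set (WhiskerVertex n)), m v ≠ 0 := by
    intro m
    constructor
    · rintro ⟨_, ⟨⟨b, hb, rfl⟩, hlt⟩, hle⟩
      obtain ⟨i, hi⟩ := exists_lt_of_coverExponent_lt hlt
      refine ⟨xVertex i, mem_freeVertices.2 ⟨i, hi.trans_le (hb.le i), rfl⟩, fun h0 => ?_⟩
      have h1 : b i ≤ m (xVertex i) + a i := hle (xVertex i)
      omega
    · rintro ⟨v, hv, hmv⟩
      obtain ⟨i, hi, rfl⟩ := mem_freeVertices.1 hv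
      refine ⟨_, ⟨⟨_, ha.add_single hi, rfl⟩, coverExponent_lt_add_single a i⟩, ?_⟩
      rw [← Finsupp.coe_le_coe, Pi.le_def, forall_whiskerVertex]
      intro j
      by_cases hj : j = i
      · subst hj
        constructor
        · simp only [coverExponent, pairExponent_xVertex, Finsupp.add_apply, Pi.add_apply,
            Pi.single_eq_same]
          omega
        · simp only [coverExponent, pairExponent_yVertex, Finsupp.add_apply, Pi.add_apply,
            Pi.single_eq_same]
          omega
      · simp [coverExponent, hj]
  ext f
  rw [Submodule.mem_colon_singleton, smul_eq_mul, mem_ideal_span_monomial_image,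
    mem_ideal_span_X_image]
  refine ⟨fun h m hm => (key m).1 (h _ ?_), fun h m hm => ?_⟩
  · rw [mem_support_iff, coeff_mul_monomial, mul_one]
    exact mem_support_iff.1 hm
  · rw [mem_support_iff, coeff_mul_monomial', mul_one] at hm
    split_ifs at hm with hle
    · obtain ⟨m, rfl⟩ := exists_add_of_le hle
      rw [add_tsub_cancel_left] at hm
      rw [add_comm]
      exact (key m).2 (h m (mem_support_iff.2 hm))
    · exact absurd rfl hm

end Combinatorics

/-- A finite set of monomials of degree `d`, listed in decreasing order, has linear quotients if
each colon ideal by the larger monomials is generated by at most `q` variables. -/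
lemma hasLinearFiltration_span_monomial {σ K : Type*} [Field K] (m : MonomialOrder σ)
    {G : Set (σ →₀ ℕ)} (hG : G.Finite) {d q : ℕ} (hdeg : ∀ u ∈ G, u.degree = d)
    (hcolon : ∀ u ∈ G, ∃ T : Finset σ, T.card ≤ q ∧
      (Ideal.span ((fun a => monomial a (1 : K)) '' {v | v ∈ G ∧ m.toSyn u < m.toSyn v})).colon
        {monomial u (1 : K)} = Ideal.span ((X : σ → MvPolynomial σ K) '' T)) :
    HasLinearFiltration {f : MvPolynomial σ K | f.IsHomogeneous d} q
      (Ideal.span ((fun a => monomial a (1 : K)) '' G)) := by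
  classical
  have key : ∀ s : Finset (σ →₀ ℕ), (s : Set (σ →₀ ℕ)) ⊆ G →
      (∀ u ∈ s, ∀ v ∈ G, m.toSyn u < m.toSyn v → v ∈ s) →
      HasLinearFiltration {f : MvPolynomial σ K | f.IsHomogeneous d} q
        (Ideal.span ((fun a => monomial a (1 : K)) '' (s : Set (σ →₀ ℕ)))) := by
    intro s
    induction s using Finset.induction_on_min_value m.toSyn with
    | empty =>
      intro _ _
      rw [Finset.coe_empty, Set.image_empty, Ideal.span_empty]
      exact .bot
    | insert u s hus hmin ih =>
      intro hsG hup
      have hlt : ∀ v ∈ s, m.toSyn u < m.toSyn v := fun v hv =>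
        lt_of_le_of_ne (hmin v hv) fun h => hus (m.toSyn.injective h ▸ hv)
      have huG : u ∈ G := hsG (by simp)
      obtain ⟨T, hT, hcol⟩ := hcolon u huG
      have hs : {v | v ∈ G ∧ m.toSyn u < m.toSyn v} = (s : Set (σ →₀ ℕ)) := by
        ext v
        refine ⟨fun hv => ?_, fun hv => ⟨hsG (by simp [Finset.mem_coe.1 hv]), hlt v hv⟩⟩
        have := hup u (by simp) v hv.1 hv.2
        rcases Finset.mem_insert.1 this with rfl | h
        · exact absurd hv.2 (lt_irrefl _)
        · exact h
      rw [hs] at hcol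
      rw [Finset.coe_insert, Set.image_insert_eq, Ideal.span, Submodule.span_insert, sup_comm]
      refine .sup_span _ T (ih (fun v hv => hsG (by simp [Finset.mem_coe.1 hv])) ?_) ?_ hT hcol
      · intro v hv w hw hvw
        rcases Finset.mem_insert.1 (hup v (by simp [hv]) w hw hvw) with rfl | h
        · exact absurd (hvw.trans (hlt v hv)) (lt_irrefl _)
        · exact h
      · rw [Set.mem_ofPred_eq]
        exact isHomogeneous_monomial _ (hdeg u huG)
  have := key hG.toFinset (by simp) fun u _ v hv _ => by simpa using hv
  rwa [hG.coe_toFinset] at this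

section Powers

variable {K : Type*} [Field K] {n : ℕ} (H : SimpleGraph (Fin n))

lemma hasLinearQuotients_coverIdeal_pow (k : ℕ) :
    HasLinearQuotients MonomialOrder.lex (coverIdeal K (whiskerGraph H) ^ k) := by
  refine ⟨⟨_, coverIdeal_pow H K k⟩, ?_⟩
  rw [minimalGenerators_coverIdeal_pow]
  rintro _ ⟨a, ha, rfl⟩
  exact ⟨_, colon_coverGenerators ha⟩

lemma hasLinearFiltration_coverIdeal_pow {k q : ℕ}
    (hq : ∀ a, IsCoverSum H k a → (Finset.univ.filter fun i => a i < k).card ≤ q) :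
    HasLinearFiltration {f : MvPolynomial (WhiskerVertex n) K | f.IsHomogeneous (n * k)} q
      (coverIdeal K (whiskerGraph H) ^ k) := by
  rw [coverIdeal_pow]
  refine hasLinearFiltration_span_monomial MonomialOrder.lex ((finite_isCoverSum k).image _) ?_ ?_
  · rintro _ ⟨a, ha, rfl⟩
    exact degree_coverExponent ha.le
  · rintro _ ⟨a, ha, rfl⟩
    exact ⟨freeVertices k a, (card_freeVertices k a).trans_le (hq a ha), colon_coverGenerators ha⟩

lemma hasLinearPowers_coverIdeal : HasLinearPowers (coverIdeal K (whiskerGraph H)) := fun _ _ =>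
  (hasLinearFiltration_coverIdeal_pow (q := n) H fun _ _ =>
    (Finset.card_le_univ _).trans_eq (Fintype.card_fin n)).hasLinearResolution

end Powers

/-! ### Depth and Koszul homology -/

section Depth

open Koszul

/-- If `S / I` has no Koszul homology in degree `p + 1`, then a boundary in degree `p` with
coefficients in `I` is the boundary of a chain with coefficients in `I`. -/
lemma Koszul.AcyclicAt.exists_d_eq_mem {R σ : Type*} [CommRing R] [Fintype σ] [LinearOrder σ]
    {x : σ → R} {I : Ideal R} {p : ℕ} (h : AcyclicAt x (R ⧸ I) (p + 1)) {w : Finset σ → R}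
    (hw : ∀ s : Finset σ, s.card ≠ p + 1 → w s = 0) (hI : ∀ s, d x w s ∈ I) :
    ∃ w' : Finset σ → R, (∀ s, w' s ∈ I) ∧ d x w' = d x w := by
  obtain ⟨v, hv⟩ := h (fun s => Submodule.mkQ I (w s))
    (fun s hs => by rw [hw s hs, map_zero]) (by
      ext s
      rw [d_comp, Submodule.mkQ_apply, Pi.zero_apply, Submodule.Quotient.mk_eq_zero]
      exact hI s)
  choose v' hv' using fun s => Submodule.mkQ_surjective I (v s)
  refine ⟨w - d x v', fun s => ?_, by rw [map_sub, d_d, sub_zero]⟩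
  rw [Pi.sub_apply, ← Submodule.Quotient.mk_eq_zero, ← Submodule.mkQ_apply, map_sub, ← d_comp,
    ← congrFun hv s]
  simp only [hv', sub_self]

variable {σ K : Type*} [Field K] [Fintype σ] [LinearOrder σ]

/-- A nonzero Koszul homology module in degree `p` bounds the depth by `|σ| - p`. -/
lemma quotientDepth_le_of_not_acyclicAt {I : Ideal (MvPolynomial σ K)} {p : ℕ}
    (h : ¬ AcyclicAt (X : σ → MvPolynomial σ K) (MvPolynomial σ K ⧸ I) p) :
    quotientDepth I ≤ ((Fintype.card σ - p : ℕ) : ℕ∞) := by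
  refine sSup_le ?_
  rintro _ ⟨rs, hrs, hreg, rfl⟩
  rw [Nat.cast_le]
  by_contra! hlt
  exact h (.of_isWeaklyRegular hrs hreg.toIsWeaklyRegular (by omega))

/-- Vanishing of the Koszul homology above degree `p` bounds the depth from below by `|σ| - p`. -/
lemma le_quotientDepth_of_acyclicAt {I : Ideal (MvPolynomial σ K)} {p : ℕ}
    (hI : I ≤ idealOfVars σ K) (hp : p ≤ Fintype.card σ)
    (h : ∀ p', p < p' → AcyclicAt (X : σ → MvPolynomial σ K) (MvPolynomial σ K ⧸ I) p') :
    ((Fintype.card σ - p : ℕ) : ℕ∞) ≤ quotientDepth I := by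
  obtain ⟨rs, hrs, hreg, hlen⟩ := exists_isWeaklyRegular (x := (X : σ → MvPolynomial σ K))
    (Fintype.card σ - p) (MvPolynomial σ K ⧸ I) (fun p' hp' => h p' (by omega)) (by omega)
  refine le_sSup ⟨rs, hrs, ⟨hreg, fun htop => ?_⟩, by rw [hlen]⟩
  have hle : Ideal.ofList rs • (⊤ : Submodule (MvPolynomial σ K) (MvPolynomial σ K ⧸ I)) ≤
      LinearMap.ker (Submodule.factor hI) := by
    refine Submodule.smul_le.2 fun r hr m _ => ?_
    obtain ⟨f, rfl⟩ := Submodule.mkQ_surjective _ m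
    rw [LinearMap.mem_ker, ← map_smul, Submodule.factor_mk, Submodule.mkQ_apply,
      Submodule.Quotient.mk_eq_zero, smul_eq_mul]
    exact Ideal.mul_mem_right _ _ (Ideal.span_le.2 hrs hr)
  rw [← htop] at hle
  have h1 := hle (Submodule.mem_top (x := Submodule.mkQ I 1))
  rw [LinearMap.mem_ker, Submodule.factor_mk, Submodule.mkQ_apply,
    Submodule.Quotient.mk_eq_zero, ← pow_one (idealOfVars σ K), mem_pow_idealOfVars_iff'] at h1
  simpa using h1 0 (by simp)

end Depth

/-! ### A nonzero Koszul class on the powers of the cover ideal -/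

section Cycle

open Koszul

variable {K : Type*} [Field K] {n : ℕ} {H : SimpleGraph (Fin n)}

/-- The Koszul cycle `∏ (x_i e_{y_i} - y_i e_{x_i})`, `i ∈ T`, has its coefficients in
`∏ (x_i, y_i)`, and its coefficient at `∏ e_{x_i}` is `∏ y_i` up to sign. -/
lemma exists_koszul_cycle (K : Type*) [Field K] (T : Finset (Fin n)) :
    ∃ z : Finset (WhiskerVertex n) → MvPolynomial (WhiskerVertex n) K,
      d (X : WhiskerVertex n → MvPolynomial (WhiskerVertex n) K) z = 0 ∧
      (∀ s : Finset (WhiskerVertex n), s.card ≠ T.card → z s = 0) ∧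
      (∀ s, z s ∈ ∏ i ∈ T, Ideal.span {X (xVertex i), X (yVertex i)}) ∧
      ∃ ε, ε * ε = 1 ∧ z (T.image xVertex) = ε * ∏ i ∈ T, X (yVertex i) := by
  classical
  induction T using Finset.induction_on with
  | empty =>
    refine ⟨fun s => if s = ∅ then 1 else 0, ?_, fun s hs => if_neg fun h => hs (by simp [h]),
      fun s => by simp, 1, by simp⟩
    ext1 s
    rw [d_apply]
    exact Finset.sum_eq_zero fun i _ => by simp
  | insert i T hi ih =>
    set S := MvPolynomial (WhiskerVertex n) K
    obtain ⟨z, hd, hdeg, hmem, ε, hε, hz⟩ := ih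
    have hE : ∀ (v : WhiskerVertex n) (s : Finset (WhiskerVertex n)), s.card ≠ T.card + 1 →
        mulE S v z s = 0 := fun v s hs => by
      rw [mulE_apply]
      split_ifs with hv
      · rw [hdeg _ fun h => hs (by rw [← h, Finset.card_erase_add_one hv]), smul_zero]
      · rfl
    have hEmem : ∀ (v : WhiskerVertex n) (s : Finset (WhiskerVertex n)),
        mulE S v z s ∈ ∏ i ∈ T, Ideal.span {(X (xVertex i) : S), X (yVertex i)} := fun v s => by
      rw [mulE_apply]
      split_ifs
      · exact Submodule.smul_mem _ _ (hmem _)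
      · exact Submodule.zero_mem _
    refine ⟨(X (xVertex i) : S) • mulE S (yVertex i) z - (X (yVertex i) : S) • mulE S (xVertex i) z,
      ?_, fun s hs => ?_, fun s => ?_, ?_⟩
    · rw [map_sub, map_smul, map_smul, d_mulE, d_mulE, hd, map_zero, map_zero, sub_zero, sub_zero,
        smul_smul, smul_smul, mul_comm, sub_self]
    · rw [Finset.card_insert_of_notMem hi] at hs
      simp [hE _ s hs]
    · rw [Finset.prod_insert hi]
      exact Submodule.sub_mem _
        (Ideal.mul_mem_mul (Ideal.subset_span (by simp)) (hEmem _ s))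
        (Ideal.mul_mem_mul (Ideal.subset_span (by simp)) (hEmem _ s))
    · have hx : xVertex i ∉ T.image xVertex := by simpa [xVertex_injective.eq_iff] using hi
      have hy : yVertex i ∉ insert (xVertex i) (T.image xVertex) := by
        simp [xVertex_ne_yVertex, (xVertex_ne_yVertex _ _).symm]
      refine ⟨-(sign S (xVertex i) (insert (xVertex i) (T.image xVertex)) * ε), ?_, ?_⟩
      · rw [neg_mul_neg, mul_mul_mul_comm, Koszul.sign_mul_self, hε, one_mul]
      · rw [Finset.image_insert, Pi.sub_apply, Pi.smul_apply, Pi.smul_apply, mulE_apply, mulE_apply,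
          if_neg hy, if_pos (Finset.mem_insert_self _ _), Finset.erase_insert hx, hz,
          Finset.prod_insert hi]
        simp only [smul_eq_mul]
        ring

/-- The exponent vector of `∏ x_i ^ (a i) * y_i ^ (k - a i)` divided by the `y_i`, `i ∈ T`. -/
def reducedExponent (k : ℕ) (a : Fin n → ℕ) (T : Finset (Fin n)) : WhiskerVertex n →₀ ℕ :=
  pairExponent a fun i => k - a i - if i ∈ T then 1 else 0

lemma monomial_reducedExponent_mul_prod {k : ℕ} {a : Fin n → ℕ} {T : Finset (Fin n)}
    (hT : ∀ i ∈ T, a i < k) :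
    monomial (reducedExponent k a T) (1 : K) * ∏ i ∈ T, X (yVertex i) =
      monomial (coverExponent k a) 1 := by
  classical
  induction T using Finset.induction_on with
  | empty =>
    rw [Finset.prod_empty, mul_one]
    congr 1
  | insert i T hi ih =>
    rw [← ih fun j hj => hT j (Finset.mem_insert_of_mem hj), Finset.prod_insert hi, ← mul_assoc, X,
      monomial_mul, one_mul, reducedExponent, pairExponent_add_single_yVertex, reducedExponent]
    congr 4
    ext j
    have := hT i (Finset.mem_insert_self i T)
    by_cases hj : j = i
    · subst hj; simp [hi]; omega
    · simp [hj]

lemma monomial_reducedExponent_mul_mem {k : ℕ} {T : Finset (Fin n)} :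
    ∀ {a : Fin n → ℕ}, IsCoverSum H k a → (∀ i ∈ T, a i < k) →
    ∀ f ∈ ∏ i ∈ T, Ideal.span {(X (xVertex i) : MvPolynomial (WhiskerVertex n) K), X (yVertex i)},
      monomial (reducedExponent k a T) (1 : K) * f ∈ coverIdeal K (whiskerGraph H) ^ k := by
  classical
  induction T using Finset.induction_on with
  | empty =>
    intro a ha _ f _
    refine Ideal.mul_mem_right _ _ ?_
    exact monomial_mem_coverIdeal_pow.2 ⟨a, ha, le_rfl⟩
  | insert i T hi ih =>
    intro a ha hT f hf
    rw [Finset.prod_insert hi] at hf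
    have hik := hT i (Finset.mem_insert_self i T)
    have hTk : ∀ j ∈ T, a j < k := fun j hj => hT j (Finset.mem_insert_of_mem hj)
    have hne : ∀ j ∈ T, j ≠ i := fun j hj h => hi (h ▸ hj)
    -- multiplication by `x_i` raises the entry `a i`, multiplication by `y_i` cancels the division
    have hx : monomial (reducedExponent k a (insert i T)) (1 : K) * X (xVertex i) =
        monomial (reducedExponent k (a + Pi.single i 1) T) 1 := by
      rw [X, monomial_mul, one_mul, reducedExponent, pairExponent_add_single_xVertex,
        reducedExponent]
      congr 3
      ext j
      by_cases hj : j = i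
      · subst hj; simp [hi]; omega
      · simp [hj]
    have hy : monomial (reducedExponent k a (insert i T)) (1 : K) * X (yVertex i) =
        monomial (reducedExponent k a T) 1 := by
      rw [X, monomial_mul, one_mul, reducedExponent, pairExponent_add_single_yVertex,
        reducedExponent]
      congr 3
      ext j
      by_cases hj : j = i
      · subst hj; simp [hi]; omega
      · simp [hj]
    refine Submodule.mul_induction_on hf (fun g hg h hh => ?_) fun g h hg hh => ?_
    · obtain ⟨α, β, rfl⟩ := Ideal.mem_span_pair.1 hg
      have h1 := ih (ha.add_single hik) (fun j hj => by simpa [hne j hj] using hTk j hj) h hh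
      have h2 := ih ha hTk h hh
      rw [← hx] at h1
      rw [← hy] at h2
      convert Submodule.add_mem _ (Ideal.mul_mem_left _ α h1) (Ideal.mul_mem_left _ β h2) using 1
      ring
    · rw [mul_add]
      exact Submodule.add_mem _ hg hh

lemma coverIdeal_le_pow_idealOfVars :
    coverIdeal K (whiskerGraph H) ≤ idealOfVars (WhiskerVertex n) K ^ n := by
  classical
  rw [coverIdeal_whiskerGraph, Ideal.span_le]
  rintro _ ⟨_, ⟨a, ha, rfl⟩, rfl⟩
  rw [SetLike.mem_coe, mem_pow_idealOfVars_iff]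
  intro m hm
  rw [support_monomial, if_neg one_ne_zero, Finset.mem_singleton] at hm
  rw [hm, degree_coverExponent ha.le, mul_one]

/-- The Koszul homology of `S / J ^ (k + 1)` in degree `|{i | a i < k}| + 1` is nonzero. The cycle
`∏ (x_i e_{y_i} - y_i e_{x_i})` times `∏ x_i` and a monomial has coefficients in `J ^ (k + 1)` of the
least possible degree, so that it does not bound a chain with coefficients in `J ^ (k + 1)`, whereas
it bounds over `S` because of the factor `∏ x_i`. -/
lemma not_acyclicAt_coverIdeal_pow (hn : 1 ≤ n) {k : ℕ} {a : Fin n → ℕ} (ha : IsCoverSum H k a) :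
    ¬ AcyclicAt (X : WhiskerVertex n → MvPolynomial (WhiskerVertex n) K)
      (MvPolynomial (WhiskerVertex n) K ⧸ coverIdeal K (whiskerGraph H) ^ (k + 1))
      ((Finset.univ.filter fun i => a i < k).card + 1) := by
  classical
  intro hac
  set T := Finset.univ.filter fun i => a i < k
  set S := MvPolynomial (WhiskerVertex n) K
  have hT : ∀ i ∈ T, a i < k := fun i hi => (Finset.mem_filter.1 hi).2
  obtain ⟨z, hd, hdeg, hmem, ε, hε, hz⟩ := exists_koszul_cycle K T
  set c : S := monomial (coverExponent 1 1) 1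
  set w : S := monomial (reducedExponent k a T) 1
  have hcJ : c ∈ coverIdeal K (whiskerGraph H) := by
    have := (monomial_mem_coverIdeal_pow (K := K) (H := H) (k := 1)).2
      ⟨_, IsCoverSum.of_const 1, le_rfl⟩
    rwa [pow_one] at this
  have hc : c ∈ Ideal.span (Set.range (X : WhiskerVertex n → S)) :=
    Ideal.pow_le_self (by omega) (coverIdeal_le_pow_idealOfVars hcJ)
  obtain ⟨h, hh, hhdeg⟩ := exists_homotopy (M := S) hc
  have hdw : d X (h (w • z)) = c • w • z := hh _ (by rw [map_smul, hd, smul_zero])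
  obtain ⟨w', hw', hdw'⟩ := hac.exists_d_eq_mem (w := h (w • z))
    (hhdeg _ _ fun s hs => by rw [Pi.smul_apply, hdeg s hs, smul_zero]) (fun s => by
      rw [hdw, pow_succ', Pi.smul_apply, Pi.smul_apply]
      exact Ideal.mul_mem_mul hcJ (monomial_reducedExponent_mul_mem ha hT _ (hmem s)))
  have hs := congrFun (hdw'.trans hdw) (T.image xVertex)
  rw [Pi.smul_apply, Pi.smul_apply, hz, d_apply] at hs
  have hle : coverIdeal K (whiskerGraph H) ^ (k + 1) ≤
      idealOfVars (WhiskerVertex n) K ^ (n * (k + 1)) := by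
    rw [pow_mul]
    exact Ideal.pow_right_mono coverIdeal_le_pow_idealOfVars _
  have hin : c • w • (ε * ∏ i ∈ T, X (yVertex i)) ∈
      idealOfVars (WhiskerVertex n) K ^ (n * (k + 1) + 1) := by
    rw [← hs]
    refine Submodule.sum_mem _ fun v _ => ?_
    rw [pow_succ', smul_eq_mul]
    exact Ideal.mul_mem_mul (Ideal.mul_mem_left _ _ (Ideal.subset_span ⟨v, rfl⟩)) (hle (hw' _))
  -- the coefficient at `∏ e_{x_i}` is a monomial of degree `n * (k + 1)`, up to sign
  have hmon : ε * (c • w • (ε * ∏ i ∈ T, X (yVertex i))) =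
      monomial (coverExponent 1 1 + coverExponent k a) (1 : K) := by
    have : ε * (c • w • (ε * ∏ i ∈ T, X (yVertex i))) =
        (ε * ε) * (c * (w * ∏ i ∈ T, X (yVertex i))) := by
      simp only [smul_eq_mul]; ring
    rw [this, hε, one_mul, monomial_reducedExponent_mul_prod hT, monomial_mul, one_mul]
  have hin' := Ideal.mul_mem_left _ ε hin
  rw [hmon, mem_pow_idealOfVars_iff'] at hin'
  have := hin' (coverExponent 1 1 + coverExponent k a) (by
    rw [map_add, degree_coverExponent (k := 1) (a := 1) (fun _ => le_rfl),
      degree_coverExponent ha.le, mul_add]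
    omega)
  simp at this

/-- The maximal number `q` of variables in a colon ideal determines the depth of `S / J ^ k` as
`2 * n - 1 - q`; it does not decrease when passing to `J ^ (k + 1)`. -/
lemma quotientDepth_coverIdeal_pow_succ_le (hn : 1 ≤ n) {k : ℕ} (hk : 1 ≤ k) :
    quotientDepth (coverIdeal K (whiskerGraph H) ^ (k + 1)) ≤
      quotientDepth (coverIdeal K (whiskerGraph H) ^ k) := by
  obtain ⟨a, ha, hmax⟩ := Set.exists_max_image {a | IsCoverSum H k a}
    (fun a => (Finset.univ.filter fun i => a i < k).card) (finite_isCoverSum k)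
    ⟨_, IsCoverSum.of_const k⟩
  have hnot := not_acyclicAt_coverIdeal_pow (K := K) hn ha
  refine (quotientDepth_le_of_not_acyclicAt hnot).trans (le_quotientDepth_of_acyclicAt ?_ ?_ ?_)
  · exact (Ideal.pow_le_self (by omega)).trans
      (coverIdeal_le_pow_idealOfVars.trans (Ideal.pow_le_self (by omega)))
  · by_contra! hlt
    exact hnot (.of_card_lt _ hlt)
  · exact fun p hp => (hasLinearFiltration_coverIdeal_pow H hmax).acyclicAt hp

end Cycle

end

theorem corollary4p6 {K : Type*} [Field K] (n : ℕ) (hn : 1 ≤ n) (H : SimpleGraph (Fin n)) :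
    (∀ k : ℕ, 1 ≤ k →
      HasLinearQuotients MonomialOrder.lex (coverIdeal K (whiskerGraph H) ^ k)) ∧
    HasLinearPowers (coverIdeal K (whiskerGraph H)) ∧
    (∀ k : ℕ, 1 ≤ k →
      quotientDepth (coverIdeal K (whiskerGraph H) ^ (k + 1)) ≤
        quotientDepth (coverIdeal K (whiskerGraph H) ^ k)) :=
  ⟨fun k _ => hasLinearQuotients_coverIdeal_pow H k, hasLinearPowers_coverIdeal H,
    fun _ hk => quotientDepth_coverIdeal_pow_succ_le hn hk⟩
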